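/- Let $G=(V,E)$ be a finite connected undirected simple graph with vertex set $V=\{1,\dots,n\}$, $n\ge 2$, where $E$ contains each edge in both orientations $(i,j)$ and $(j,i)$, and let $N(i)=\{j:(i,j)\in E\}$. Let $\Delta x>0$, $\beta>0$, $(v_i)\in\mathbb R^n$, and let $W=(w_{ij})$ be a real symmetric $n\times n$ matrix. Put $$\mathcal F(\rho)=\sum_i v_i\rho_i+\tfrac12\sum_{i,j}w_{ij}\rho_i\rho_j+\beta\sum_i\rho_i\log\rho_i,\qquad F_i=\frac{\partial\mathcal F}{\partial\rho_i},\qquad f_{ij}=\frac{\partial^2\mathcal F}{\partial\rho_i\partial\rho_j},$$ let $\mathcal P_o(G)=\{\rho\in\mathbb R^n:\rho_i>0,\ \sum_i\rho_i=1\}$, and let $(\cdot)_+=\max\{\cdot,0\}$. Consider on $\mathcal P_o(G)$ the ordinary differential equation $$\frac{d\rho_i}{dt}=\frac1{\Delta x^2}\Big\{\sum_{j\in N(i)}\rho_j\,(F_j(\rho)-F_i(\rho))_+-\sum_{j\in N(i)}\rho_i\,(F_i(\rho)-F_j(\rho))_+\Big\}.\tag{a1}$$ A Gibbs measure is a probability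 vector $\rho$ with $$\rho_i=\frac1K e^{-\frac1\beta\left(v_i+\sum_j w_{ij}\rho_j\right)}\quad(i\in V),\qquad K=\sum_{k} e^{-\frac1\beta\left(v_k+\sum_j w_{kj}\rho_j\right)}.$$ For $\rho\in\mathcal P_o(G)$ define $$\lambda_{\mathcal F}(\rho)=\min_{\Phi\in D}\ \sum_{(i,j)\in E}\sum_{(k,l)\in E}h_{ij,kl}\Big(\frac{\Phi_i-\Phi_j}{\Delta x}\Big)_+\rho_i\Big(\frac{\Phi_k-\Phi_l}{\Delta x}\Big)_+\rho_k,\qquad h_{ij,kl}=\frac{f_{ik}+f_{jl}-f_{il}-f_{jk}}{\Delta x^2},$$ where the $f$'s are evaluated at $\rho$ and $D=\{\Phi\in\mathbb R^n:\sum_{(i,j)\in E}(\frac{\Phi_i-\Phi_j}{\Delta x})_+^2\rho_i=1\}$. Suppose that $W$ is positive semidefinite. Then for every $\rho^0\in\mathcal P_o(G)$, (a1) has a unique solution $\rho:[0,\infty)\to\mathcal P_o(G)$ with $\rho(0)=\rho^0$. There is exactly one Gibbs measure $\rho^\infty$. It is a global attractor of (a1): it lies in $\mathcal P_o(G)$,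 it is a Lyapunov stable equilibrium, and $\rho(t)\to\rho^\infty$ as $t\to\infty$ for every solution, uniformly in the initial condition $\rho^0\in\mathcal P_o(G)$. There is a constant $C>0$ such that for every solution and every $t\ge0$ $$\mathcal F(\rho(t))-\mathcal F(\rho^\infty)\le e^{-Ct}\big(\mathcal F(\rho^0)-\mathcal F(\rho^\infty)\big).$$ Moreover the minimum $\lambda_{\mathcal F}(\rho^\infty)$ is attained and positive, and the asymptotic convergence rate is $2\lambda_{\mathcal F}(\rho^\infty)$: for every solution $\rho$ and every $\varepsilon>0$ there is $T>0$ such that for all $t\ge T$ $$\mathcal F(\rho(t))-\mathcal F(\rho^\infty)\le e^{-2(\lambda_{\mathcal F}(\rho^\infty)-\varepsilon)(t-T)}\big(\mathcal F(\rho(T))-\mathcal F(\rho^\infty)\big).$$ -/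

import Mathlib

open Set Filter Topology

noncomputable section

namespace GraphFlow

variable {V : Type*} [Fintype V] [DecidableEq V]

/-- The set `P_o(G)` of strictly positive probability vectors on the vertices. -/
def posSimplex (V : Type*) [Fintype V] : Set (V → ℝ) :=
  {ρ | (∀ i, 0 < ρ i) ∧ ∑ i, ρ i = 1}

/-- The discrete free energy: linear potential, interaction and entropy. -/
def freeEnergy (v : V → ℝ) (W : Matrix V V ℝ) (β : ℝ) (ρ : V → ℝ) : ℝ :=
  ∑ i, v i * ρ i + (1 / 2) * ∑ i, ∑ j, W i j * ρ i * ρ j + β * ∑ i, ρ i * Real.log (ρ i)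

/-- The partial derivative `∂f/∂ρ_i` of a function on `ℝ^V`. -/
def partialDeriv (f : (V → ℝ) → ℝ) (i : V) (ρ : V → ℝ) : ℝ :=
  lineDeriv ℝ f ρ (Pi.single i 1)

/-- `F_i(ρ) = ∂𝓕/∂ρ_i (ρ)`. -/
def firstVar (v : V → ℝ) (W : Matrix V V ℝ) (β : ℝ) (i : V) (ρ : V → ℝ) : ℝ :=
  partialDeriv (freeEnergy v W β) i ρ

/-- `f_ij(ρ) = ∂²𝓕/∂ρ_i∂ρ_j (ρ)`. -/
def secondVar (v : V → ℝ) (W : Matrix V V ℝ) (β : ℝ) (i j : V) (ρ : V → ℝ) : ℝ :=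
  partialDeriv (partialDeriv (freeEnergy v W β) j) i ρ

/-- The right-hand side of the semi-discretization scheme with mesh size `Δx`. -/
def schemeRHS (G : SimpleGraph V) [DecidableRel G.Adj] (v : V → ℝ) (W : Matrix V V ℝ)
    (β Δx : ℝ) (ρ : V → ℝ) : V → ℝ := fun i =>
  1 / Δx ^ 2 *
    (∑ j ∈ G.neighborFinset i, ρ j * max (firstVar v W β j ρ - firstVar v W β i ρ) 0
      - ∑ j ∈ G.neighborFinset i, ρ i * max (firstVar v W β i ρ - firstVar v W β j ρ) 0)

/-- `ρ : [0, ∞) → P_o(G)` solves the scheme (only the values at times `t ≥ 0` matter; the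
derivative is one-sided at `t = 0`). -/
def IsSolution (G : SimpleGraph V) [DecidableRel G.Adj] (v : V → ℝ) (W : Matrix V V ℝ)
    (β Δx : ℝ) (ρ : ℝ → V → ℝ) : Prop :=
  ∀ t, 0 ≤ t → ρ t ∈ posSimplex V ∧
    HasDerivWithinAt ρ (schemeRHS G v W β Δx (ρ t)) (Ici 0) t

/-- A discrete Gibbs measure: a probability vector with
`ρ_i = K⁻¹ exp (-(v_i + ∑_j w_ij ρ_j) / β)`, `K` being the normalizing constant. -/
def IsGibbs (v : V → ℝ) (W : Matrix V V ℝ) (β : ℝ) (ρ : V → ℝ) : Prop :=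
  ρ ∈ stdSimplex ℝ V ∧
    ∀ i, ρ i = Real.exp (-(v i + ∑ j, W i j * ρ j) / β) /
      ∑ k, Real.exp (-(v k + ∑ j, W k j * ρ j) / β)

/-- The point `p` is a global attractor of the scheme on the phase space `P_o(G)`: it is an
equilibrium, it is Lyapunov stable, every solution converges to it, and the convergence is uniform
over all initial data (the whole phase space is bounded, so this says that bounded sets of initial
data are attracted). -/
structure IsGlobalAttractor (G : SimpleGraph V) [DecidableRel G.Adj] (v : V → ℝ)
    (W : Matrix V V ℝ) (β Δx : ℝ) (p : V → ℝ) : Prop where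
  mem : p ∈ posSimplex V
  equilibrium : schemeRHS G v W β Δx p = 0
  stable : ∀ ε > 0, ∃ δ > 0, ∀ ρ : ℝ → V → ℝ, IsSolution G v W β Δx ρ →
    dist (ρ 0) p < δ → ∀ t, 0 ≤ t → dist (ρ t) p < ε
  converges : ∀ ρ : ℝ → V → ℝ, IsSolution G v W β Δx ρ → Tendsto ρ atTop (𝓝 p)
  uniform : ∀ ε > 0, ∃ T > 0, ∀ ρ : ℝ → V → ℝ, IsSolution G v W β Δx ρ →
    ∀ t, T ≤ t → dist (ρ t) p < ε

/-- `h_{ij,kl} = (f_ik + f_jl - f_il - f_jk) / Δx²`. -/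
def hCoeff (v : V → ℝ) (W : Matrix V V ℝ) (β Δx : ℝ) (ρ : V → ℝ) (i j k l : V) : ℝ :=
  (secondVar v W β i k ρ + secondVar v W β j l ρ - secondVar v W β i l ρ
    - secondVar v W β j k ρ) / Δx ^ 2

/-- The objective whose minimum is `λ_𝓕(ρ)`. The sums over edges are over ordered pairs. -/
def rateForm (G : SimpleGraph V) [DecidableRel G.Adj] (v : V → ℝ) (W : Matrix V V ℝ)
    (β Δx : ℝ) (ρ Φ : V → ℝ) : ℝ :=
  ∑ i, ∑ j ∈ G.neighborFinset i, ∑ k, ∑ l ∈ G.neighborFinset k,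
    hCoeff v W β Δx ρ i j k l * max ((Φ i - Φ j) / Δx) 0 * ρ i
      * max ((Φ k - Φ l) / Δx) 0 * ρ k

/-- The constraint set `D` of potentials. -/
def rateDomain (G : SimpleGraph V) [DecidableRel G.Adj] (Δx : ℝ) (ρ : V → ℝ) : Set (V → ℝ) :=
  {Φ | ∑ i, ∑ j ∈ G.neighborFinset i, max ((Φ i - Φ j) / Δx) 0 ^ 2 * ρ i = 1}

/-- `lam` is the dissipation rate `λ_𝓕(ρ)`, the minimum of `rateForm` on `rateDomain`. -/
def IsRate (G : SimpleGraph V) [DecidableRel G.Adj] (v : V → ℝ) (W : Matrix V V ℝ)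
    (β Δx : ℝ) (ρ : V → ℝ) (lam : ℝ) : Prop :=
  IsLeast (rateForm G v W β Δx ρ '' rateDomain G Δx ρ) lam

end GraphFlow

end

/-! At positive densities the scheme is `ρ' = -flux(ρ, Φ) / Δx²`, with `Φ` the gradient of the free
energy, and summation by parts gives `𝓕' = -D(ρ, Φ) / Δx²` for the upwind Dirichlet energy `D`. The
convergence statements thus reduce to bounding `D` below by the energy gap and applying Grönwall.

Positive semidefiniteness of `W` and the entropy make `𝓕` strongly convex on the open simplex
(`strongConvexity`). Gibbs measures are its critical points, so there is at most one; the logarithm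
keeps a constrained minimizer off the boundary, so there is one, called `p`.

Global decay (`exists_entropy_dissipation`): if `D` is not small, boundedness of `𝓕` suffices. If
`D` is small, potentials cannot drop much along edges, so a vertex of mass at least `1/n` forces a
uniform lower bound on `ρ` along paths; a Poincaré inequality and strong convexity then apply.

Sharp rate: near `p`, with `δ = ρ - p` and `H` the Hessian, the gap is `⟨δ, Hδ⟩ / 2` and the
dissipation `D_p(Hδ)`, up to `o(|δ|²)`. The definition of `λ` gives `⟨X, HX⟩ ≥ λ Δx² D_p(Φ)` for `X
= flux(p, Φ)`, whereas `D_p(Hδ) ≥ λ Δx² ⟨δ, Hδ⟩` is needed. For a linear symmetric flux the two are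
dual. The upwind flux is nonlinear, but it is half the gradient of the 2-homogeneous `D_p`, so a
minimizer `e` of `D_p(He)` under `⟨e, He⟩ = 1` solves `flux(p, He) = μ e`; the first inequality at
`Φ = He` gives `λ Δx² ≤ μ` (`mul_hess_le_dirichlet`).

Well-posedness: the field is Lipschitz away from the boundary, and at a vertex of minimal density
mass is lost at most at a linear rate, so solutions stay above an exponential barrier. -/

set_option linter.unusedSectionVars false

noncomputable section

namespace GraphFlow

variable {V : Type*} [Fintype V] [DecidableEq V]

/-! ### First and second variations of the free energy. -/

section Variations

/-- The explicit formula for the first variation of the free energy at positive densities. -/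
def potential (v : V → ℝ) (W : Matrix V V ℝ) (β : ℝ) (ρ : V → ℝ) (i : V) : ℝ :=
  v i + ∑ j, W i j * ρ j + β * (Real.log (ρ i) + 1)

/-- The Hessian of the free energy at `p`, as an operator. -/
def hess (W : Matrix V V ℝ) (β : ℝ) (p δ : V → ℝ) (i : V) : ℝ :=
  ∑ j, W i j * δ j + β * (δ i / p i)

/-- The upwind net outflow generated by the density `ρ` and the potential `Φ`. -/
def flux (G : SimpleGraph V) [DecidableRel G.Adj] (ρ Φ : V → ℝ) (i : V) : ℝ :=
  ∑ j ∈ G.neighborFinset i, ρ i * max (Φ i - Φ j) 0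
    - ∑ j ∈ G.neighborFinset i, ρ j * max (Φ j - Φ i) 0

/-- The upwind Dirichlet energy. -/
def dirichlet (G : SimpleGraph V) [DecidableRel G.Adj] (ρ Φ : V → ℝ) : ℝ :=
  ∑ i, ∑ j ∈ G.neighborFinset i, ρ i * max (Φ i - Φ j) 0 ^ 2

/-- General curves and sets allow one chain rule to serve the partial derivatives, the mass
transfers at a minimizer and the dissipation identity. -/
lemma hasDerivWithinAt_freeEnergy {v : V → ℝ} {W : Matrix V V ℝ} (hW : W.IsSymm) {β : ℝ}
    {γ : ℝ → V → ℝ} {γ' : V → ℝ} {s : Set ℝ} {t : ℝ} (h : HasDerivWithinAt γ γ' s t)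
    (hpos : ∀ i, 0 < γ t i) :
    HasDerivWithinAt (fun u => freeEnergy v W β (γ u))
      (∑ i, potential v W β (γ t) i * γ' i) s t := by
  have hc : ∀ i, HasDerivWithinAt (fun u => γ u i) (γ' i) s t := hasDerivWithinAt_pi.1 h
  have h1 : HasDerivWithinAt (fun u => ∑ i, v i * γ u i) (∑ i, v i * γ' i) s t :=
    HasDerivWithinAt.fun_sum fun i _ => (hc i).const_mul (v i)
  have h2 : HasDerivWithinAt (fun u => ∑ i, ∑ j, W i j * γ u i * γ u j)
      (∑ i, ∑ j, (W i j * γ' i * γ t j + W i j * γ t i * γ' j)) s t :=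
    HasDerivWithinAt.fun_sum fun i _ => HasDerivWithinAt.fun_sum fun j _ =>
      ((hc i).const_mul (W i j)).mul (hc j)
  have h3 : HasDerivWithinAt (fun u => ∑ i, γ u i * Real.log (γ u i))
      (∑ i, (Real.log (γ t i) + 1) * γ' i) s t :=
    HasDerivWithinAt.fun_sum fun i _ =>
      (Real.hasDerivAt_mul_log (hpos i).ne').comp_hasDerivWithinAt (h := fun u => γ u i) t (hc i)
  refine ((h1.add (h2.const_mul (1 / 2))).add (h3.const_mul β)).congr_deriv ?_
  have hs : ∑ i, ∑ j, W i j * γ t i * γ' j = ∑ i, ∑ j, W i j * γ' i * γ t j := by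
    rw [Finset.sum_comm]
    refine Finset.sum_congr rfl fun i _ => Finset.sum_congr rfl fun j _ => ?_
    rw [hW.apply i j]; ring
  have e : ∀ i, potential v W β (γ t) i * γ' i = v i * γ' i + ∑ j, W i j * γ' i * γ t j
      + β * ((Real.log (γ t i) + 1) * γ' i) := fun i => by
    rw [potential, add_mul, add_mul, Finset.sum_mul, mul_assoc β]
    simp only [mul_right_comm]
  simp only [e, Finset.sum_add_distrib, hs, ← Finset.mul_sum]
  ring

lemma firstVar_eq {v : V → ℝ} {W : Matrix V V ℝ} (hW : W.IsSymm) {β : ℝ} {ρ : V → ℝ}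
    (hρ : ∀ i, 0 < ρ i) (i : V) : firstVar v W β i ρ = potential v W β ρ i := by
  have hline : HasDerivWithinAt (fun t : ℝ => ρ + t • (Pi.single i 1 : V → ℝ))
      (Pi.single i 1) univ 0 := by
    rw [hasDerivWithinAt_univ]
    simpa using ((hasDerivAt_id (0 : ℝ)).smul_const (Pi.single i 1 : V → ℝ)).const_add ρ
  have := hasDerivWithinAt_freeEnergy (v := v) hW (β := β) hline (by simpa using hρ)
  rw [hasDerivWithinAt_univ] at this
  simpa [firstVar, partialDeriv, lineDeriv, Pi.single_apply] using this.deriv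

lemma secondVar_eq {v : V → ℝ} {W : Matrix V V ℝ} (hW : W.IsSymm) {β : ℝ} {ρ : V → ℝ}
    (hρ : ∀ i, 0 < ρ i) (i j : V) :
    secondVar v W β i j ρ = W i j + if i = j then β / ρ i else 0 := by
  have hline : ∀ k, HasDerivAt (fun t : ℝ => (ρ + t • (Pi.single i 1 : V → ℝ)) k)
      ((Pi.single i 1 : V → ℝ) k) 0 := fun k => by
    simpa using ((hasDerivAt_id (0 : ℝ)).mul_const ((Pi.single i 1 : V → ℝ) k)).const_add (ρ k)
  -- The formula for the first variation is known only at positive densities, so it is substituted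
  -- near `t = 0`, where positivity persists.
  have hev : (fun t : ℝ => firstVar v W β j (ρ + t • (Pi.single i 1 : V → ℝ))) =ᶠ[𝓝 0]
      fun t => potential v W β (ρ + t • (Pi.single i 1 : V → ℝ)) j := by
    have : ∀ᶠ t : ℝ in 𝓝 0, ∀ k, 0 < (ρ + t • (Pi.single i 1 : V → ℝ)) k := by
      refine eventually_all.2 fun k => (hline k).continuousAt.eventually_const_lt ?_
      simpa using hρ k
    filter_upwards [this] with t ht using firstVar_eq hW ht j
  have hd : HasDerivAt (fun t : ℝ => potential v W β (ρ + t • (Pi.single i 1 : V → ℝ)) j)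
      (W j i + β * ((ρ j)⁻¹ * (Pi.single i 1 : V → ℝ) j)) 0 := by
    have h1 : HasDerivAt (fun t : ℝ => ∑ k, W j k * (ρ + t • (Pi.single i 1 : V → ℝ)) k)
        (∑ k, W j k * (Pi.single i 1 : V → ℝ) k) 0 :=
      HasDerivAt.fun_sum fun k _ => (hline k).const_mul _
    have h2 := (((hline j).log (by simpa using (hρ j).ne')).add_const 1).const_mul β
    refine ((h1.const_add (v j)).add h2).congr_deriv ?_
    simp [Pi.single_apply, div_eq_inv_mul]
  rw [secondVar, partialDeriv, lineDeriv, show partialDeriv (freeEnergy v W β) j =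
    firstVar v W β j from rfl, hev.deriv_eq, hd.deriv, hW.apply j i]
  rcases eq_or_ne i j with rfl | h
  · simp [div_eq_mul_inv]
  · simp [h, Ne.symm h]

/-! ### Calculus of the upwind flux and its Dirichlet energy. -/

section Flux

variable (G : SimpleGraph V) [DecidableRel G.Adj]

lemma sum_neighborFinset_eq (f : V → V → ℝ) :
    ∑ i, ∑ j ∈ G.neighborFinset i, f i j = ∑ i, ∑ j, if G.Adj i j then f i j else 0 := by
  refine Finset.sum_congr rfl fun i _ => ?_
  rw [← Finset.sum_filter]
  refine Finset.sum_congr ?_ fun _ _ => rfl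
  ext j; simp

lemma sum_neighborFinset_comm (f : V → V → ℝ) :
    ∑ i, ∑ j ∈ G.neighborFinset i, f i j = ∑ i, ∑ j ∈ G.neighborFinset i, f j i := by
  rw [sum_neighborFinset_eq, sum_neighborFinset_eq, Finset.sum_comm]
  simp only [G.adj_comm]

/-- Summation by parts: what leaves `i` along an edge arrives at `j`. Taking `g = 1` gives
conservation of mass, and `g = Φ` gives the Dirichlet energy. -/
lemma sum_mul_flux (ρ Φ g : V → ℝ) :
    ∑ i, g i * flux G ρ Φ i =
      ∑ i, ∑ j ∈ G.neighborFinset i, ρ i * max (Φ i - Φ j) 0 * (g i - g j) := by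
  simp only [flux, mul_sub, Finset.sum_sub_distrib, Finset.mul_sum]
  rw [sum_neighborFinset_comm G fun i j => g i * (ρ j * max (Φ j - Φ i) 0)]
  congr 1 <;> exact Finset.sum_congr rfl fun i _ => Finset.sum_congr rfl fun j _ => by ring

lemma sum_flux (ρ Φ : V → ℝ) : ∑ i, flux G ρ Φ i = 0 := by
  simpa using sum_mul_flux G ρ Φ fun _ => 1

lemma max_zero_mul_self (x : ℝ) : max x 0 * x = max x 0 ^ 2 := by
  rcases le_total x 0 with h | h <;> simp [h, sq]

lemma sum_self_mul_flux (ρ Φ : V → ℝ) : ∑ i, Φ i * flux G ρ Φ i = dirichlet G ρ Φ := by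
  rw [sum_mul_flux]
  simp only [mul_assoc, max_zero_mul_self, dirichlet]

lemma dirichlet_nonneg {ρ : V → ℝ} (hρ : ∀ i, 0 ≤ ρ i) (Φ : V → ℝ) : 0 ≤ dirichlet G ρ Φ :=
  Finset.sum_nonneg fun i _ => Finset.sum_nonneg fun _ _ => mul_nonneg (hρ i) (sq_nonneg _)

lemma dirichlet_smul (ρ Φ : V → ℝ) {s : ℝ} (hs : 0 ≤ s) :
    dirichlet G ρ (s • Φ) = s ^ 2 * dirichlet G ρ Φ := by
  simp only [dirichlet, Finset.mul_sum]
  refine Finset.sum_congr rfl fun i _ => Finset.sum_congr rfl fun j _ => ?_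
  have : max (s * Φ i - s * Φ j) 0 = s * max (Φ i - Φ j) 0 := by
    rw [mul_max_of_nonneg _ _ hs, mul_sub, mul_zero]
  simp only [Pi.smul_apply, smul_eq_mul, this]; ring

lemma flux_smul (ρ Φ : V → ℝ) {s : ℝ} (hs : 0 ≤ s) : flux G ρ (s • Φ) = s • flux G ρ Φ := by
  have : ∀ i j, max (s * Φ i - s * Φ j) 0 = s * max (Φ i - Φ j) 0 := fun i j => by
    rw [mul_max_of_nonneg _ _ hs, mul_sub, mul_zero]
  ext i
  simp only [flux, Pi.smul_apply, smul_eq_mul, this, mul_sub, Finset.mul_sum]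
  congr 1 <;> exact Finset.sum_congr rfl fun j _ => by ring

lemma flux_sub_const (ρ Φ : V → ℝ) (c : ℝ) : flux G ρ (fun i => Φ i - c) = flux G ρ Φ := by
  ext i; simp [flux]

lemma dirichlet_sub_const (ρ Φ : V → ℝ) (c : ℝ) :
    dirichlet G ρ (fun i => Φ i - c) = dirichlet G ρ Φ := by
  simp [dirichlet]

lemma mul_max_sq_le_dirichlet {ρ : V → ℝ} (hρ : ∀ i, 0 ≤ ρ i) (Φ : V → ℝ) {i j : V}
    (h : G.Adj i j) : ρ i * max (Φ i - Φ j) 0 ^ 2 ≤ dirichlet G ρ Φ := by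
  have h0 : ∀ i j, 0 ≤ ρ i * max (Φ i - Φ j) 0 ^ 2 := fun i j => mul_nonneg (hρ i) (sq_nonneg _)
  calc _ ≤ ∑ j ∈ G.neighborFinset i, ρ i * max (Φ i - Φ j) 0 ^ 2 :=
        Finset.single_le_sum (f := fun j => ρ i * max (Φ i - Φ j) 0 ^ 2) (fun j _ => h0 i j)
          (by simpa using h)
    _ ≤ _ := Finset.single_le_sum
        (f := fun i => ∑ j ∈ G.neighborFinset i, ρ i * max (Φ i - Φ j) 0 ^ 2)
        (fun i _ => Finset.sum_nonneg fun j _ => h0 i j) (Finset.mem_univ i)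

lemma schemeRHS_eq {v : V → ℝ} {W : Matrix V V ℝ} (hW : W.IsSymm) {β Δx : ℝ} {ρ : V → ℝ}
    (hρ : ∀ i, 0 < ρ i) :
    schemeRHS G v W β Δx ρ = fun i => -(1 / Δx ^ 2) * flux G ρ (potential v W β ρ) i := by
  ext i
  simp only [schemeRHS, flux, firstVar_eq hW hρ]
  ring

end Flux

end Variations

/-! ### Strong convexity and the Gibbs measure. -/

section Convexity

lemma posSimplex_le_one {ρ : V → ℝ} (h : ρ ∈ posSimplex V) (i : V) : ρ i ≤ 1 :=
  h.2 ▸ Finset.single_le_sum (f := ρ) (fun j _ => (h.1 j).le) (Finset.mem_univ i)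

lemma sq_sub_div_four_le_relativeEntropy {x y : ℝ} (hx : 0 < x) (hy : 0 < y) (hx1 : x ≤ 1)
    (hy1 : y ≤ 1) : (x - y) ^ 2 / 4 ≤ x * Real.log (x / y) - x + y := by
  set a := √x
  set b := √y
  have ha : 0 < a := Real.sqrt_pos.2 hx
  have hb : 0 < b := Real.sqrt_pos.2 hy
  have hax : x = a ^ 2 := (Real.sq_sqrt hx.le).symm
  have hby : y = b ^ 2 := (Real.sq_sqrt hy.le).symm
  have ha1 : a ≤ 1 := Real.sqrt_le_one.2 hx1
  have hb1 : b ≤ 1 := Real.sqrt_le_one.2 hy1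
  have hlog : Real.log (x / y) = -2 * Real.log (b / a) := by
    rw [hax, hby, Real.log_div (by positivity) (by positivity), Real.log_div hb.ne' ha.ne',
      Real.log_pow, Real.log_pow]
    push_cast; ring
  -- Applying `log z ≤ z - 1` to the ratio of square roots bounds the relative entropy below by `(√x
  -- - √y)²`; the factor 4 comes from `√x + √y ≤ 2`.
  have h1 : Real.log (b / a) ≤ b / a - 1 := Real.log_le_sub_one_of_pos (by positivity)
  have h2 : a ^ 2 * Real.log (b / a) ≤ a * b - a ^ 2 := by
    calc _ ≤ a ^ 2 * (b / a - 1) := by gcongr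
      _ = _ := by field_simp
  have h3 : (a - b) ^ 2 ≤ x * Real.log (x / y) - x + y := by
    rw [hlog, hax, hby]; nlinarith
  refine le_trans ?_ h3
  have : (x - y) ^ 2 = (a - b) ^ 2 * (a + b) ^ 2 := by rw [hax, hby]; ring
  rw [this]
  have : (a + b) ^ 2 ≤ 4 := by nlinarith
  nlinarith [sq_nonneg (a - b)]

lemma sum_mul_sum_nonneg {W : Matrix V V ℝ} (hW : W.PosSemidef) (x : V → ℝ) :
    0 ≤ ∑ i, x i * ∑ j, W i j * x j := by
  have := hW.dotProduct_mulVec_nonneg x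
  simpa [dotProduct, Matrix.mulVec] using this

lemma posSemidef_isSymm {W : Matrix V V ℝ} (hW : W.PosSemidef) : W.IsSymm := by
  have := hW.isHermitian
  rwa [Matrix.IsHermitian, Matrix.conjTranspose_eq_transpose_of_trivial] at this

/-- The second order remainder of the free energy. -/
lemma freeEnergy_sub {v : V → ℝ} {W : Matrix V V ℝ} (hW : W.IsSymm) (β : ℝ) {σ ρ : V → ℝ}
    (hσ : ∀ i, 0 < σ i) (hρ : ∀ i, 0 < ρ i) :
    freeEnergy v W β σ - freeEnergy v W β ρ = ∑ i, potential v W β ρ i * (σ i - ρ i)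
      + 1 / 2 * ∑ i, (σ i - ρ i) * ∑ j, W i j * (σ j - ρ j)
      + β * ∑ i, (σ i * Real.log (σ i / ρ i) - σ i + ρ i) := by
  have hs : ∑ i, ∑ j, W i j * ρ i * σ j = ∑ i, ∑ j, W i j * σ i * ρ j := by
    rw [Finset.sum_comm]
    refine Finset.sum_congr rfl fun i _ => Finset.sum_congr rfl fun j _ => ?_
    rw [hW.apply i j]; ring
  have h1 : ∑ i, potential v W β ρ i * (σ i - ρ i) = ∑ i, v i * σ i - ∑ i, v i * ρ i
      + (∑ i, ∑ j, W i j * σ i * ρ j - ∑ i, ∑ j, W i j * ρ i * ρ j)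
      + β * ∑ i, (Real.log (ρ i) + 1) * (σ i - ρ i) := by
    rw [Finset.mul_sum, ← Finset.sum_sub_distrib, ← Finset.sum_sub_distrib,
      ← Finset.sum_add_distrib, ← Finset.sum_add_distrib]
    refine Finset.sum_congr rfl fun i _ => ?_
    have e1 : ∑ j, W i j * σ i * ρ j = σ i * ∑ j, W i j * ρ j := by
      rw [Finset.mul_sum]; exact Finset.sum_congr rfl fun j _ => by ring
    have e2 : ∑ j, W i j * ρ i * ρ j = ρ i * ∑ j, W i j * ρ j := by
      rw [Finset.mul_sum]; exact Finset.sum_congr rfl fun j _ => by ring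
    rw [e1, e2, potential]; ring
  have h2 : ∑ i, (σ i - ρ i) * ∑ j, W i j * (σ j - ρ j) =
      ∑ i, ∑ j, W i j * σ i * σ j - 2 * ∑ i, ∑ j, W i j * σ i * ρ j
      + ∑ i, ∑ j, W i j * ρ i * ρ j := by
    rw [two_mul]
    nth_rw 2 [← hs]
    simp only [← Finset.sum_add_distrib, ← Finset.sum_sub_distrib, Finset.mul_sum]
    exact Finset.sum_congr rfl fun i _ => Finset.sum_congr rfl fun j _ => by ring
  have h3 : ∑ i, (σ i * Real.log (σ i / ρ i) - σ i + ρ i) = ∑ i, σ i * Real.log (σ i)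
      - ∑ i, ρ i * Real.log (ρ i) - ∑ i, (Real.log (ρ i) + 1) * (σ i - ρ i) := by
    simp only [← Finset.sum_sub_distrib]
    refine Finset.sum_congr rfl fun i _ => ?_
    rw [Real.log_div (hσ i).ne' (hρ i).ne']; ring
  rw [h1, h2, h3, freeEnergy, freeEnergy]
  ring

/-- In the exact remainder of `freeEnergy_sub` the interaction part is nonnegative and the relative
entropy dominates a quarter of the squared distance. -/
lemma strongConvexity {v : V → ℝ} {W : Matrix V V ℝ} (hW : W.PosSemidef) {β : ℝ} (hβ : 0 < β)
    {σ ρ : V → ℝ} (hσ : σ ∈ posSimplex V) (hρ : ρ ∈ posSimplex V) :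
    ∑ i, potential v W β ρ i * (σ i - ρ i) + β / 4 * ∑ i, (σ i - ρ i) ^ 2
      ≤ freeEnergy v W β σ - freeEnergy v W β ρ := by
  rw [freeEnergy_sub (posSemidef_isSymm hW) β hσ.1 hρ.1]
  have h1 := sum_mul_sum_nonneg hW fun i => σ i - ρ i
  have h2 : ∑ i, (σ i - ρ i) ^ 2 / 4 ≤ ∑ i, (σ i * Real.log (σ i / ρ i) - σ i + ρ i) :=
    Finset.sum_le_sum fun i _ => sq_sub_div_four_le_relativeEntropy (hσ.1 i) (hρ.1 i)
      (posSimplex_le_one hσ i) (posSimplex_le_one hρ i)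
  rw [← Finset.sum_div] at h2
  nlinarith [mul_le_mul_of_nonneg_left h2 hβ.le]

lemma sum_const_mul_sub {f σ ρ : V → ℝ} {c : ℝ} (hf : ∀ i, f i = c) (hσ : σ ∈ posSimplex V)
    (hρ : ρ ∈ posSimplex V) : ∑ i, f i * (σ i - ρ i) = 0 := by
  rw [Finset.sum_congr rfl fun i _ => by rw [hf i], ← Finset.mul_sum, Finset.sum_sub_distrib,
    hσ.2, hρ.2, sub_self, mul_zero]

/-- An interior critical point minimizes the free energy, with quadratic growth. -/
lemma quadratic_growth {v : V → ℝ} {W : Matrix V V ℝ} (hW : W.PosSemidef) {β : ℝ} (hβ : 0 < β)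
    {p ρ : V → ℝ} {c : ℝ} (hp : p ∈ posSimplex V) (hc : ∀ i, potential v W β p i = c)
    (hρ : ρ ∈ posSimplex V) :
    β / 4 * ∑ i, (ρ i - p i) ^ 2 ≤ freeEnergy v W β ρ - freeEnergy v W β p := by
  have := strongConvexity (v := v) hW hβ hρ hp
  rwa [sum_const_mul_sub hc hρ hp, zero_add] at this

/-- Gibbs measures are the positive probability vectors with constant potential. -/
lemma isGibbs_iff {v : V → ℝ} {W : Matrix V V ℝ} {β : ℝ} (hβ : 0 < β) [Nonempty V] {ρ : V → ℝ} :
    IsGibbs v W β ρ ↔ ρ ∈ posSimplex V ∧ ∃ c, ∀ i, potential v W β ρ i = c := by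
  have hK : 0 < ∑ k, Real.exp (-(v k + ∑ j, W k j * ρ j) / β) :=
    Finset.sum_pos (fun _ _ => Real.exp_pos _) Finset.univ_nonempty
  constructor
  · rintro ⟨hs, h⟩
    have hpos : ∀ i, 0 < ρ i := fun i => by
      rw [h i]; exact div_pos (Real.exp_pos _) hK
    refine ⟨⟨hpos, hs.2⟩, β * (1 - Real.log (∑ k, Real.exp (-(v k + ∑ j, W k j * ρ j) / β))),
      fun i => ?_⟩
    have : Real.log (ρ i) = -(v i + ∑ j, W i j * ρ j) / β
        - Real.log (∑ k, Real.exp (-(v k + ∑ j, W k j * ρ j) / β)) := by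
      conv_lhs => rw [h i]
      rw [Real.log_div (Real.exp_pos _).ne' hK.ne', Real.log_exp]
    rw [potential, this]
    field_simp
    ring
  · rintro ⟨hs, c, hc⟩
    refine ⟨⟨fun i => (hs.1 i).le, hs.2⟩, fun i => ?_⟩
    have he : ∀ k, Real.exp (-(v k + ∑ j, W k j * ρ j) / β) = Real.exp (1 - c / β) * ρ k := by
      intro k
      have : -(v k + ∑ j, W k j * ρ j) / β = 1 - c / β + Real.log (ρ k) := by
        rw [← hc k, potential]
        field_simp
        ring
      rw [this, Real.exp_add, Real.exp_log (hs.1 k)]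
    simp only [he, ← Finset.mul_sum, hs.2, mul_one]
    field_simp

/-- Only the logarithm is unbounded on the simplex. This turns comparisons of potentials into
comparisons of log-densities, at a cost of `2 * B`. -/
lemma exists_abs_potential_le (v : V → ℝ) (W : Matrix V V ℝ) (β : ℝ) :
    ∃ B > 0, ∀ ρ ∈ posSimplex V, ∀ i, |potential v W β ρ i - β * Real.log (ρ i)| ≤ B := by
  refine ⟨∑ i, (|v i| + ∑ j, |W i j|) + |β| + 1, by positivity, fun ρ hρ i => ?_⟩
  have h1 : |∑ j, W i j * ρ j| ≤ ∑ j, |W i j| := by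
    refine (Finset.abs_sum_le_sum_abs _ _).trans (Finset.sum_le_sum fun j _ => ?_)
    rw [abs_mul, abs_of_pos (hρ.1 j)]
    exact mul_le_of_le_one_right (abs_nonneg _) (posSimplex_le_one hρ j)
  have h2 : |v i| + ∑ j, |W i j| ≤ ∑ i, (|v i| + ∑ j, |W i j|) :=
    Finset.single_le_sum (f := fun i => |v i| + ∑ j, |W i j|)
      (fun i _ => by positivity) (Finset.mem_univ i)
  have h3 : potential v W β ρ i - β * Real.log (ρ i) = v i + ∑ j, W i j * ρ j + β := by
    rw [potential]; ring
  rw [h3]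
  have := abs_add_le (v i + ∑ j, W i j * ρ j) β
  have := abs_add_le (v i) (∑ j, W i j * ρ j)
  linarith

lemma continuous_freeEnergy (v : V → ℝ) (W : Matrix V V ℝ) (β : ℝ) :
    Continuous (freeEnergy v W β) := by
  have : ∀ i : V, Continuous fun ρ : V → ℝ => ρ i * Real.log (ρ i) := fun i =>
    Real.continuous_mul_log.comp (continuous_apply i)
  unfold freeEnergy
  fun_prop

lemma exists_inv_card_le [Nonempty V] {ρ : V → ℝ} (hρ : ρ ∈ posSimplex V) :
    ∃ k, (Fintype.card V : ℝ)⁻¹ ≤ ρ k := by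
  have hn : (0 : ℝ) < Fintype.card V := by exact_mod_cast Fintype.card_pos
  obtain ⟨k, -, hk⟩ := Finset.exists_le_of_sum_le (s := Finset.univ)
    (f := fun _ : V => (Fintype.card V : ℝ)⁻¹) (g := ρ) Finset.univ_nonempty (by
      rw [hρ.2]; simp [hn.ne'])
  exact ⟨k, hk⟩

/-- Existence of an interior critical point of the free energy. -/
lemma exists_potential_const [Nonempty V] (v : V → ℝ) {W : Matrix V V ℝ} (hW : W.IsSymm) {β : ℝ}
    (hβ : 0 < β) : ∃ p ∈ posSimplex V, ∃ c, ∀ i, potential v W β p i = c := by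
  obtain ⟨B, hB, hbd⟩ := exists_abs_potential_le v W β
  have hn : (0 : ℝ) < Fintype.card V := by exact_mod_cast Fintype.card_pos
  set N : ℝ := (Fintype.card V : ℝ)⁻¹ with hN
  have hNpos : 0 < N := by positivity
  -- Chosen so that `β log ε + B < β log N - B`: a coordinate at the floor `ε` has strictly smaller
  -- potential than one of mass at least `N = 1/n`.
  set ε : ℝ := N * Real.exp (-(2 * B + 1) / β) with hε
  have hεpos : 0 < ε := by positivity
  have hεN : ε < N := by
    refine mul_lt_of_lt_one_right hNpos (Real.exp_lt_one_iff.2 ?_)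
    rw [neg_div]; exact neg_neg_of_pos (by positivity)
  have hlogε : β * Real.log ε = β * Real.log N - (2 * B + 1) := by
    rw [hε, Real.log_mul hNpos.ne' (Real.exp_pos _).ne', Real.log_exp]; field_simp; ring
  let K : Set (V → ℝ) := {ρ | (∀ i, ε ≤ ρ i) ∧ ∑ i, ρ i = 1}
  have hKsub : K ⊆ posSimplex V := fun ρ h => ⟨fun i => hεpos.trans_le (h.1 i), h.2⟩
  have hKcpt : IsCompact K := by
    refine (isCompact_stdSimplex ℝ V).of_isClosed_subset ?_
      fun ρ h => ⟨fun i => ((hKsub h).1 i).le, h.2⟩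
    refine IsClosed.inter (isClosed_le continuous_const continuous_id :
      IsClosed {ρ : V → ℝ | (fun _ => ε) ≤ ρ}) ?_
    exact isClosed_eq (by fun_prop) continuous_const
  have hKne : K.Nonempty := ⟨fun _ => N, fun _ => hεN.le, by simp [hN, hn.ne']⟩
  obtain ⟨p, hpK, hmin⟩ := hKcpt.exists_isMinOn hKne (continuous_freeEnergy v W β).continuousOn
  have hp := hKsub hpK
  -- Moving a little mass from `j` to `i` stays in `K` when `p j > ε`, so the one-sided derivative
  -- of the energy in that direction is nonnegative.
  have hle : ∀ i j, ε < p j → potential v W β p j ≤ potential v W β p i := by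
    intro i j hj
    by_contra! hlt
    have hij : i ≠ j := by rintro rfl; exact lt_irrefl _ hlt
    have hline : HasDerivAt (fun t : ℝ => p + t • (Pi.single i 1 - Pi.single j 1 : V → ℝ))
        (Pi.single i 1 - Pi.single j 1) 0 := by
      simpa using ((hasDerivAt_id (0 : ℝ)).smul_const
        (Pi.single i 1 - Pi.single j 1 : V → ℝ)).const_add p
    have hd := hasDerivWithinAt_freeEnergy (v := v) hW (β := β)
      (hline.hasDerivWithinAt (s := univ)) (by simpa using hp.1)
    rw [hasDerivWithinAt_univ] at hd
    have hval : ∑ k, potential v W β (p + (0 : ℝ) • (Pi.single i 1 - Pi.single j 1 : V → ℝ)) k *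
        (Pi.single i 1 - Pi.single j 1 : V → ℝ) k
        = potential v W β p i - potential v W β p j := by
      simp [mul_sub, Finset.sum_sub_distrib, Pi.single_apply]
    rw [hval] at hd
    have hev : ∀ᶠ t : ℝ in 𝓝[>] 0, freeEnergy v W β p ≤
        freeEnergy v W β (p + t • (Pi.single i 1 - Pi.single j 1 : V → ℝ)) := by
      have h1 : ∀ᶠ t : ℝ in 𝓝[>] 0, t < p j - ε :=
        mem_nhdsWithin_of_mem_nhds (Iio_mem_nhds (by linarith))
      filter_upwards [h1, self_mem_nhdsWithin] with t ht1 ht0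
      have ht0 : 0 < t := ht0
      refine hmin ⟨fun k => ?_, ?_⟩
      · have := hpK.1 k
        rcases eq_or_ne k j with rfl | hkj
        · simp [Ne.symm hij]; linarith
        · rcases eq_or_ne k i with rfl | hki
          · simp [hkj]; linarith
          · simp [hkj, hki, this]
      · simp [Finset.sum_add_distrib, hp.2, ← Finset.mul_sum]
    have hslope := (hasDerivWithinAt_iff_tendsto_slope' (by simp)).1
      (hd.hasDerivWithinAt (s := Ioi 0))
    have : 0 ≤ potential v W β p i - potential v W β p j := by
      refine ge_of_tendsto hslope ?_
      filter_upwards [hev, self_mem_nhdsWithin] with t ht ht0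
      have ht0 : 0 < t := ht0
      rw [slope_def_field]
      simp only [zero_smul, add_zero, sub_zero]
      exact div_nonneg (by linarith) ht0.le
    linarith
  obtain ⟨k, hk⟩ := exists_inv_card_le hp
  have hint : ∀ i, ε < p i := by
    intro i
    by_contra! hi
    have hi : p i = ε := le_antisymm hi (hpK.1 i)
    have h1 := hle i k (hεN.trans_le hk)
    have h2 := abs_le.1 (hbd p hp i)
    have h3 := abs_le.1 (hbd p hp k)
    rw [hi, hlogε] at h2
    have h4 : β * Real.log N ≤ β * Real.log (p k) := by gcongr
    linarith
  exact ⟨p, hp, potential v W β p k, fun i => le_antisymm (hle k i (hint i)) (hle i k (hint k))⟩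

/-- In the sum of the two quadratic growth inequalities the energies cancel. -/
lemma eq_of_potential_const {v : V → ℝ} {W : Matrix V V ℝ} (hW : W.PosSemidef) {β : ℝ}
    (hβ : 0 < β) {p q : V → ℝ} {c d : ℝ} (hp : p ∈ posSimplex V)
    (hc : ∀ i, potential v W β p i = c) (hq : q ∈ posSimplex V)
    (hd : ∀ i, potential v W β q i = d) : q = p := by
  have h1 := quadratic_growth hW hβ hp hc hq
  have h2 := quadratic_growth hW hβ hq hd hp
  have h3 : ∑ i, (p i - q i) ^ 2 = ∑ i, (q i - p i) ^ 2 :=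
    Finset.sum_congr rfl fun i _ => by ring
  have h4 : ∑ i, (q i - p i) ^ 2 = 0 := by
    refine le_antisymm ?_ (by positivity)
    nlinarith
  ext i
  have := (Finset.sum_eq_zero_iff_of_nonneg fun i _ => sq_nonneg (q i - p i)).1 h4 i
    (Finset.mem_univ i)
  exact sub_eq_zero.1 (pow_eq_zero_iff two_ne_zero |>.1 this)

end Convexity

/-! ### Poincaré inequality and global entropy-dissipation inequality. -/

section EntropyDissipation

section Poincare

variable (G : SimpleGraph V) [DecidableRel G.Adj]

lemma walk_sub_le {Φ : V → ℝ} {M : ℝ} (h : ∀ i j, G.Adj i j → Φ i - Φ j ≤ M) {u w : V}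
    (p : G.Walk u w) : Φ u - Φ w ≤ p.length * M := by
  induction p with
  | nil => simp
  | cons hadj p ih =>
    have := h _ _ hadj
    rw [SimpleGraph.Walk.length_cons]; push_cast
    linarith

lemma exists_walk_length_le (hG : G.Connected) (u w : V) :
    ∃ p : G.Walk u w, p.length ≤ Fintype.card V := by
  obtain ⟨p, hp⟩ := (hG u w).exists_isPath
  exact ⟨p, hp.length_lt.le⟩

/-- Poincaré inequality for the upwind Dirichlet energy. -/
lemma poincare (hG : G.Connected) {ρ : V → ℝ} {ε : ℝ} (hε : 0 < ε) (hρ : ∀ i, ε ≤ ρ i)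
    (Φ : V → ℝ) (u w : V) :
    ε * (Φ u - Φ w) ^ 2 ≤ (Fintype.card V : ℝ) ^ 2 * dirichlet G ρ Φ := by
  have hρ0 : ∀ i, 0 ≤ ρ i := fun i => hε.le.trans (hρ i)
  have hD := dirichlet_nonneg G hρ0 Φ
  set D := dirichlet G ρ Φ with hDdef
  -- The upwind energy sees only positive increments, but every edge occurs in both orientations, so
  -- differences are controlled in both directions.
  have hedge : ∀ i j, G.Adj i j → Φ i - Φ j ≤ √(D / ε) := by
    intro i j hij
    refine (le_max_left _ 0).trans (Real.le_sqrt_of_sq_le ?_)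
    rw [le_div_iff₀ hε, mul_comm]
    exact (mul_le_mul_of_nonneg_right (hρ i) (sq_nonneg _)).trans
      (mul_max_sq_le_dirichlet G hρ0 Φ hij)
  have key : ∀ u w, Φ u - Φ w ≤ Fintype.card V * √(D / ε) := by
    intro u w
    obtain ⟨p, hp⟩ := exists_walk_length_le G hG u w
    refine (walk_sub_le G hedge p).trans ?_
    gcongr
  have h1 : (Φ u - Φ w) ^ 2 ≤ (Fintype.card V * √(D / ε)) ^ 2 :=
    sq_le_sq' (by linarith [key w u]) (key u w)
  rw [mul_pow, Real.sq_sqrt (by positivity)] at h1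
  calc _ ≤ ε * ((Fintype.card V : ℝ) ^ 2 * (D / ε)) := by gcongr
    _ = _ := by field_simp

lemma exists_pos_forall_le [Nonempty V] {p : V → ℝ} (hp : ∀ i, 0 < p i) :
    ∃ m > 0, ∀ i, m ≤ p i := by
  obtain ⟨k, hk⟩ := Finite.exists_min p
  exact ⟨p k, hp k, hk⟩

/-- Small dissipation forces the density to stay away from the boundary of the simplex. -/
lemma exists_le_of_dirichlet_lt [Nonempty V] (hG : G.Connected) (v : V → ℝ) (W : Matrix V V ℝ)
    {β : ℝ} (hβ : 0 < β) : ∃ ε > 0, ∀ ρ ∈ posSimplex V,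
      dirichlet G ρ (potential v W β ρ) < ε → ∀ i, ε ≤ ρ i := by
  obtain ⟨B, hB, hbd⟩ := exists_abs_potential_le v W β
  have hn : (0 : ℝ) < Fintype.card V := by exact_mod_cast Fintype.card_pos
  set N : ℝ := (Fintype.card V : ℝ)⁻¹
  have hN : 0 < N := by positivity
  set M : ℝ := (1 + 2 * B) / β
  have hM : 0 < M := by positivity
  -- `M` bounds the drop of `log ρ` across one edge, and at most `n` edges are crossed from a vertex
  -- of mass at least `N`.
  set ε : ℝ := Real.exp (Real.log N - Fintype.card V * M)
  refine ⟨ε, Real.exp_pos _, fun ρ hρ hD i => ?_⟩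
  have hiff : ∀ j, ε ≤ ρ j ↔ Real.log N - Fintype.card V * M ≤ Real.log (ρ j) := fun j =>
    (Real.le_log_iff_exp_le (hρ.1 j)).symm
  -- As `ρ i ≥ ε > D`, the positive part of the potential drop is below one. The same `ε` bounds
  -- dissipation and density.
  have hstep : ∀ i j, G.Adj i j → ε ≤ ρ i → Real.log (ρ i) - M ≤ Real.log (ρ j) := by
    intro i j hij hi
    have h1 := mul_max_sq_le_dirichlet G (fun i => (hρ.1 i).le) (potential v W β ρ) hij
    set x := potential v W β ρ i - potential v W β ρ j with hx
    have h2 : max x 0 < 1 := by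
      by_contra! h
      have : ρ i * 1 ≤ ρ i * max x 0 ^ 2 :=
        mul_le_mul_of_nonneg_left (one_le_pow₀ h) (hρ.1 i).le
      linarith
    have h3 : x < 1 := (le_max_left _ _).trans_lt h2
    have h4 := abs_le.1 (hbd ρ hρ i)
    have h5 := abs_le.1 (hbd ρ hρ j)
    have h6 : β * M = 1 + 2 * B := by simp only [M]; field_simp
    have h7 : β * (Real.log (ρ i) - M) ≤ β * Real.log (ρ j) := by rw [mul_sub, h6]; linarith
    exact le_of_mul_le_mul_left h7 hβ
  -- Here `m` counts the edges already crossed; the length bound keeps each visited density above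
  -- `ε`, as the next step requires.
  have hwalk : ∀ {u w : V} (p : G.Walk u w) (m : ℕ), m + p.length ≤ Fintype.card V →
      Real.log N - m * M ≤ Real.log (ρ u) →
      Real.log N - Fintype.card V * M ≤ Real.log (ρ w) := by
    intro u w p
    have hmono : ∀ m : ℕ, m ≤ Fintype.card V →
        Real.log N - Fintype.card V * M ≤ Real.log N - m * M := fun m hm => by
      gcongr
    induction p with
    | nil => exact fun m hm h => (hmono m (by simpa using hm)).trans h
    | cons hadj p ih =>
      intro m hm h
      rw [SimpleGraph.Walk.length_cons] at hm
      refine ih (m + 1) (by omega) ?_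
      have := hstep _ _ hadj ((hiff _).2 ((hmono m (by omega)).trans h))
      push_cast
      linarith
  obtain ⟨k, hk⟩ := exists_inv_card_le hρ
  obtain ⟨p, hp⟩ := exists_walk_length_le G hG k i
  refine (hiff i).2 (hwalk p 0 (by simpa using hp) ?_)
  simpa using Real.log_le_log hN hk

/-- Global entropy-dissipation inequality. -/
lemma exists_entropy_dissipation [Nonempty V] (hG : G.Connected) (v : V → ℝ)
    {W : Matrix V V ℝ} (hW : W.PosSemidef) {β : ℝ} (hβ : 0 < β) {p : V → ℝ}
    (hp : p ∈ posSimplex V) : ∃ C > 0, ∀ ρ ∈ posSimplex V,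
      C * (freeEnergy v W β ρ - freeEnergy v W β p) ≤
        dirichlet G ρ (potential v W β ρ) := by
  obtain ⟨ε, hε, hlow⟩ := exists_le_of_dirichlet_lt G hG v W hβ
  have hn : (0 : ℝ) < Fintype.card V := by exact_mod_cast Fintype.card_pos
  set n : ℝ := (Fintype.card V : ℝ)
  obtain ⟨M, hM⟩ := (isCompact_stdSimplex ℝ V).bddAbove_image
    (continuous_freeEnergy v W β).continuousOn
  have hbd : ∀ ρ ∈ posSimplex V, freeEnergy v W β ρ ≤ M := fun ρ hρ =>
    hM ⟨ρ, ⟨fun i => (hρ.1 i).le, hρ.2⟩, rfl⟩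
  set A : ℝ := M - freeEnergy v W β p + 1 with hA
  have hA0 : 0 < A := by have := hbd p hp; linarith
  -- Two powers of `n` come from the Poincaré inequality and one from summing over the vertices.
  set C₂ : ℝ := β * ε / n ^ 3 with hC₂
  have hC20 : 0 < C₂ := by positivity
  refine ⟨min (ε / A) C₂, by positivity, fun ρ hρ => ?_⟩
  have hD := dirichlet_nonneg G (fun i => (hρ.1 i).le) (potential v W β ρ)
  set D := dirichlet G ρ (potential v W β ρ) with hDdef
  rcases le_or_gt (freeEnergy v W β ρ - freeEnergy v W β p) 0 with h0 | h0
  · exact (mul_nonpos_of_nonneg_of_nonpos (by positivity) h0).trans hD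
  rcases le_or_gt ε D with h1 | h1
  · calc _ ≤ ε / A * A := by
          gcongr
          · exact min_le_left _ _
          · have := hbd ρ hρ; linarith
      _ = ε := by field_simp
      _ ≤ D := h1
  · obtain ⟨o⟩ := ‹Nonempty V›
    have hP := poincare G hG hε (hlow ρ hρ h1) (potential v W β ρ)
    have hconv := strongConvexity (v := v) hW hβ hp hρ
    -- Since `p - ρ` has zero sum, only potential differences matter, and these the Poincaré
    -- inequality controls.
    have hsub : ∑ i, potential v W β ρ i * (p i - ρ i) =
        ∑ i, (potential v W β ρ i - potential v W β ρ o) * (p i - ρ i) := by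
      simp only [sub_mul _ (potential v W β ρ o), Finset.sum_sub_distrib (f := fun i =>
        potential v W β ρ i * (p i - ρ i))]
      rw [sum_const_mul_sub (f := fun _ => potential v W β ρ o) (fun _ => rfl) hp hρ, sub_zero]
    have hterm : ∀ i, -(1 / β * (potential v W β ρ i - potential v W β ρ o) ^ 2) ≤
        (potential v W β ρ i - potential v W β ρ o) * (p i - ρ i)
          + β / 4 * (p i - ρ i) ^ 2 := by
      intro i
      set x := potential v W β ρ i - potential v W β ρ o
      set y := p i - ρ i
      have : 0 ≤ 1 / β * (x + β / 2 * y) ^ 2 := by positivity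
      have e : 1 / β * (x + β / 2 * y) ^ 2 = 1 / β * x ^ 2 + x * y + β / 4 * y ^ 2 := by
        field_simp; ring
      linarith
    have hE : freeEnergy v W β ρ - freeEnergy v W β p ≤
        ∑ i, 1 / β * (potential v W β ρ i - potential v W β ρ o) ^ 2 := by
      have := Finset.sum_le_sum fun i (_ : i ∈ Finset.univ) => hterm i
      rw [Finset.sum_neg_distrib, Finset.sum_add_distrib, ← Finset.mul_sum (a := β / 4)] at this
      linarith
    have hE2 : ∑ i, 1 / β * (potential v W β ρ i - potential v W β ρ o) ^ 2 ≤
        ∑ _i : V, 1 / β * (n ^ 2 * D / ε) := by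
      refine Finset.sum_le_sum fun i _ => ?_
      gcongr
      rw [le_div_iff₀ hε, mul_comm]
      exact hP i o
    have hsum : ∑ _i : V, 1 / β * (n ^ 2 * D / ε) = D / C₂ := by
      rw [Finset.sum_const, Finset.card_univ, nsmul_eq_mul, hC₂]
      field_simp
      simp [n]
    calc _ ≤ C₂ * (D / C₂) := by
          gcongr
          · exact min_le_right _ _
          · linarith
      _ = D := by field_simp

end Poincare

end EntropyDissipation

/-! ### The Hessian, the rate `λ`, and its dual characterization. -/

section DissipationRate

section Hessian

variable {W : Matrix V V ℝ} {β : ℝ} {p : V → ℝ}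

lemma hess_add (x y : V → ℝ) : hess W β p (x + y) = hess W β p x + hess W β p y := by
  ext i
  simp only [hess, Pi.add_apply, mul_add, add_div, Finset.sum_add_distrib]
  ring

lemma hess_smul (s : ℝ) (x : V → ℝ) : hess W β p (s • x) = s • hess W β p x := by
  ext i
  simp only [hess, Pi.smul_apply, smul_eq_mul, mul_add, Finset.mul_sum]
  congr 1
  · exact Finset.sum_congr rfl fun j _ => by ring
  · ring

lemma sum_mul_hess_comm (hW : W.IsSymm) (x y : V → ℝ) :
    ∑ i, x i * hess W β p y i = ∑ i, y i * hess W β p x i := by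
  simp only [hess, mul_add, Finset.sum_add_distrib, Finset.mul_sum]
  congr 1
  · rw [Finset.sum_comm]
    refine Finset.sum_congr rfl fun i _ => Finset.sum_congr rfl fun j _ => ?_
    rw [hW.apply i j]; ring
  · exact Finset.sum_congr rfl fun j _ => by ring

lemma mul_sum_sq_le_hess (hW : W.PosSemidef) (hβ : 0 < β) (hp : p ∈ posSimplex V) (x : V → ℝ) :
    β * ∑ i, x i ^ 2 ≤ ∑ i, x i * hess W β p x i := by
  simp only [hess, mul_add, Finset.sum_add_distrib]
  have h1 := sum_mul_sum_nonneg hW x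
  have h2 : β * ∑ i, x i ^ 2 ≤ ∑ i, x i * (β * (x i / p i)) := by
    rw [Finset.mul_sum]
    refine Finset.sum_le_sum fun i _ => ?_
    have : x i * (β * (x i / p i)) = β * (x i ^ 2 / p i) := by ring
    rw [this]
    gcongr
    exact le_div_self (sq_nonneg _) (hp.1 i) (posSimplex_le_one hp i)
  linarith

lemma hess_nonneg (hW : W.PosSemidef) (hβ : 0 < β) (hp : p ∈ posSimplex V) (x : V → ℝ) :
    0 ≤ ∑ i, x i * hess W β p x i :=
  le_trans (by positivity) (mul_sum_sq_le_hess hW hβ hp x)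

lemma eq_zero_of_hess_le_zero (hW : W.PosSemidef) (hβ : 0 < β) (hp : p ∈ posSimplex V)
    {x : V → ℝ} (hx : ∑ i, x i * hess W β p x i ≤ 0) : x = 0 := by
  have h1 := (mul_sum_sq_le_hess hW hβ hp x).trans hx
  have h2 : ∑ i, x i ^ 2 = 0 := le_antisymm (by nlinarith) (by positivity)
  ext i
  exact pow_eq_zero_iff two_ne_zero |>.1
    ((Finset.sum_eq_zero_iff_of_nonneg fun i _ => sq_nonneg (x i)).1 h2 i (Finset.mem_univ i))

lemma continuous_hess : Continuous (hess W β p) := by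
  refine continuous_pi fun i => ?_
  unfold hess
  fun_prop

lemma norm_sq_le_sum_sq (x : V → ℝ) : ‖x‖ ^ 2 ≤ ∑ i, x i ^ 2 := by
  have h : ‖x‖ ≤ √(∑ i, x i ^ 2) := by
    refine (pi_norm_le_iff_of_nonneg (Real.sqrt_nonneg _)).2 fun i => ?_
    rw [Real.norm_eq_abs, ← Real.sqrt_sq_eq_abs]
    exact Real.sqrt_le_sqrt (Finset.single_le_sum (f := fun i => x i ^ 2)
      (fun i _ => sq_nonneg _) (Finset.mem_univ i))
  calc _ ≤ √(∑ i, x i ^ 2) ^ 2 := by gcongr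
    _ = _ := Real.sq_sqrt (by positivity)

lemma sum_secondVar_mul (hW : W.IsSymm) (v : V → ℝ) (hp : ∀ i, 0 < p i) (x : V → ℝ) (i : V) :
    ∑ k, secondVar v W β i k p * x k = hess W β p x i := by
  simp only [secondVar_eq hW hp, add_mul, Finset.sum_add_distrib, hess]
  simp
  ring

end Hessian

section Rate

variable (G : SimpleGraph V) [DecidableRel G.Adj]

lemma max_div_zero (x : ℝ) {d : ℝ} (hd : 0 < d) : max (x / d) 0 = max x 0 / d := by
  rw [← max_div_div_right hd.le, zero_div]

/-- Summation by parts in `(k, l)` and then in `(i, j)` collapses the four-index sum. Of the factors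
of `Δx`, two come from `h` and one from each weight. -/
lemma rateForm_eq {v : V → ℝ} {W : Matrix V V ℝ} (hW : W.IsSymm) {β Δx : ℝ} (hΔx : 0 < Δx)
    {p : V → ℝ} (hp : ∀ i, 0 < p i) (Φ : V → ℝ) :
    rateForm G v W β Δx p Φ =
      (∑ i, flux G p Φ i * hess W β p (flux G p Φ) i) / Δx ^ 4 := by
  set X := flux G p Φ with hX
  have hin : ∀ i j, ∑ k, ∑ l ∈ G.neighborFinset k, hCoeff v W β Δx p i j k l *
      max ((Φ i - Φ j) / Δx) 0 * p i * max ((Φ k - Φ l) / Δx) 0 * p k =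
      p i * max (Φ i - Φ j) 0 * (hess W β p X i - hess W β p X j) / Δx ^ 4 := by
    intro i j
    have h1 : hess W β p X i - hess W β p X j =
        ∑ k, (secondVar v W β i k p - secondVar v W β j k p) * X k := by
      rw [← sum_secondVar_mul hW v hp, ← sum_secondVar_mul hW v hp, ← Finset.sum_sub_distrib]
      exact Finset.sum_congr rfl fun k _ => by ring
    rw [h1, hX, sum_mul_flux, Finset.mul_sum, Finset.sum_div]
    refine Finset.sum_congr rfl fun k _ => ?_
    rw [Finset.mul_sum, Finset.sum_div]
    refine Finset.sum_congr rfl fun l _ => ?_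
    rw [hCoeff, max_div_zero _ hΔx, max_div_zero _ hΔx]
    field_simp
    ring
  simp only [rateForm, hin]
  simp only [mul_comm (X _) (hess W β p X _)]
  rw [hX, sum_mul_flux, Finset.sum_div]
  exact Finset.sum_congr rfl fun i _ => (Finset.sum_div _ _ _).symm

lemma mem_rateDomain_iff {Δx : ℝ} (hΔx : 0 < Δx) {p Φ : V → ℝ} :
    Φ ∈ rateDomain G Δx p ↔ dirichlet G p Φ = Δx ^ 2 := by
  have : ∑ i, ∑ j ∈ G.neighborFinset i, max ((Φ i - Φ j) / Δx) 0 ^ 2 * p i =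
      dirichlet G p Φ / Δx ^ 2 := by
    simp only [dirichlet, Finset.sum_div]
    refine Finset.sum_congr rfl fun i _ => Finset.sum_congr rfl fun j _ => ?_
    rw [max_div_zero _ hΔx]; ring
  rw [rateDomain, Set.mem_ofPred_eq, this, div_eq_one_iff_eq (by positivity)]

lemma continuous_dirichlet (p : V → ℝ) : Continuous (dirichlet G p) := by
  unfold dirichlet
  fun_prop

lemma continuous_flux (p : V → ℝ) : Continuous (flux G p) := by
  refine continuous_pi fun i => ?_
  unfold flux
  fun_prop

lemma exists_isRate [Nontrivial V] (hG : G.Connected) (v : V → ℝ) {W : Matrix V V ℝ}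
    (hW : W.PosSemidef) {β Δx : ℝ} (hβ : 0 < β) (hΔx : 0 < Δx) {p : V → ℝ}
    (hp : p ∈ posSimplex V) : ∃ lam > 0, IsRate G v W β Δx p lam ∧
      ∀ Φ, lam * Δx ^ 2 * dirichlet G p Φ ≤
        ∑ i, flux G p Φ i * hess W β p (flux G p Φ) i := by
  have hsymm := posSemidef_isSymm hW
  obtain ⟨m, hm, hmp⟩ := exists_pos_forall_le hp.1
  have hP := fun Φ => poincare G hG hm hmp Φ
  have hD0 := dirichlet_nonneg G (fun i => (hp.1 i).le)
  obtain ⟨o, o', hoo⟩ := exists_pair_ne V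
  -- The constraint set is invariant under adding constants, hence not compact; fixing `Φ o = 0`
  -- restores compactness by the Poincaré inequality.
  let K : Set (V → ℝ) := {Φ | Φ o = 0 ∧ dirichlet G p Φ = Δx ^ 2}
  have hKcl : IsClosed K := (isClosed_eq (continuous_apply o) continuous_const).inter
    (isClosed_eq (continuous_dirichlet G p) continuous_const)
  have hKbd : K ⊆ Metric.closedBall 0 √((Fintype.card V : ℝ) ^ 2 * Δx ^ 2 / m) := by
    rintro Φ ⟨h0, hΦ⟩
    rw [mem_closedBall_zero_iff, pi_norm_le_iff_of_nonneg (Real.sqrt_nonneg _)]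
    intro i
    refine Real.abs_le_sqrt ?_
    rw [le_div_iff₀ hm, mul_comm, ← hΦ]
    simpa [h0] using hP Φ i o
  have hKcpt : IsCompact K :=
    (isCompact_closedBall (0 : V → ℝ) _).of_isClosed_subset hKcl hKbd
  have hscale : ∀ Φ, 0 < dirichlet G p Φ → ∃ s > 0, dirichlet G p (s • Φ) = Δx ^ 2 ∧
      s ^ 2 * dirichlet G p Φ = Δx ^ 2 := by
    intro Φ hΦ
    have hs : (Δx / √(dirichlet G p Φ)) ^ 2 * dirichlet G p Φ = Δx ^ 2 := by
      rw [div_pow, Real.sq_sqrt hΦ.le]; field_simp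
    refine ⟨Δx / √(dirichlet G p Φ), div_pos hΔx (Real.sqrt_pos.2 hΦ), ?_, hs⟩
    rw [dirichlet_smul G p Φ (by positivity), hs]
  have hKne : K.Nonempty := by
    have hpos : 0 < dirichlet G p (Pi.single o' 1) := by
      have h := hP (Pi.single o' 1) o' o
      simp only [Pi.single_eq_same, Pi.single_eq_of_ne hoo, sub_zero, one_pow, mul_one] at h
      by_contra! hc
      have := mul_nonpos_of_nonneg_of_nonpos (sq_nonneg (Fintype.card V : ℝ)) hc
      linarith
    obtain ⟨s, -, hs, -⟩ := hscale _ hpos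
    exact ⟨_, by simp [hoo], hs⟩
  have hcont : Continuous fun Φ => rateForm G v W β Δx p Φ := by
    simp only [rateForm_eq G hsymm hΔx hp.1]
    have h1 := continuous_flux G p
    have h2 := continuous_hess (W := W) (β := β) (p := p)
    fun_prop
  obtain ⟨Ψ, hΨ, hmin⟩ := hKcpt.exists_isMinOn hKne hcont.continuousOn
  have hleast : IsRate G v W β Δx p (rateForm G v W β Δx p Ψ) := by
    refine ⟨⟨Ψ, (mem_rateDomain_iff G hΔx).2 hΨ.2, rfl⟩, ?_⟩
    rintro _ ⟨Φ, hΦ, rfl⟩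
    rw [mem_rateDomain_iff G hΔx] at hΦ
    have : rateForm G v W β Δx p Φ = rateForm G v W β Δx p fun i => Φ i - Φ o := by
      rw [rateForm_eq G hsymm hΔx hp.1, rateForm_eq G hsymm hΔx hp.1, flux_sub_const]
    rw [this]
    exact hmin ⟨sub_self _, by rw [dirichlet_sub_const, hΦ]⟩
  refine ⟨rateForm G v W β Δx p Ψ, ?_, hleast, fun Φ => ?_⟩
  -- A nonpositive minimum forces zero flux, hence zero Dirichlet energy by summation by parts,
  -- against the constraint.
  · by_contra! hle
    rw [rateForm_eq G hsymm hΔx hp.1, div_le_iff₀ (by positivity), zero_mul] at hle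
    have h0 := eq_zero_of_hess_le_zero hW hβ hp hle
    have h1 := sum_self_mul_flux G p Ψ
    rw [h0, hΨ.2] at h1
    have : 0 < Δx ^ 2 := by positivity
    simp at h1
    linarith
  · rcases (hD0 Φ).eq_or_lt with h0 | h0
    · rw [← h0, mul_zero]
      exact hess_nonneg hW hβ hp _
    · obtain ⟨s, hs, hs1, hs2⟩ := hscale Φ h0
      have h1 := hleast.2 ⟨s • Φ, (mem_rateDomain_iff G hΔx).2 hs1, rfl⟩
      rw [rateForm_eq G hsymm hΔx hp.1 (s • Φ), le_div_iff₀ (by positivity),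
        flux_smul G p Φ hs.le, hess_smul] at h1
      have h2 : ∑ i, (s • flux G p Φ) i * (s • hess W β p (flux G p Φ)) i =
          s ^ 2 * ∑ i, flux G p Φ i * hess W β p (flux G p Φ) i := by
        rw [Finset.mul_sum]
        exact Finset.sum_congr rfl fun i _ => by simp only [Pi.smul_apply, smul_eq_mul]; ring
      rw [h2] at h1
      have h3 : s ^ 2 * (rateForm G v W β Δx p Ψ * Δx ^ 2 * dirichlet G p Φ) ≤
          s ^ 2 * ∑ i, flux G p Φ i * hess W β p (flux G p Φ) i := by
        refine le_trans (le_of_eq ?_) h1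
        calc _ = rateForm G v W β Δx p Ψ * Δx ^ 2 * (s ^ 2 * dirichlet G p Φ) := by ring
          _ = _ := by rw [hs2]; ring
      exact le_of_mul_le_mul_left h3 (by positivity)

lemma max_add_sq_le (x y : ℝ) : max (x + y) 0 ^ 2 ≤ max x 0 ^ 2 + 2 * max x 0 * y + y ^ 2 := by
  rcases le_total x 0 with hx | hx <;> rcases le_total (x + y) 0 with h | h <;>
    simp only [max_eq_left, max_eq_right, hx, h] <;> nlinarith

/-- Identifies `2 * flux` as the gradient of the energy in `Φ`, with a quadratic remainder; this
upper bound suffices for the Euler-Lagrange equation. -/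
lemma dirichlet_add_le {p : V → ℝ} (hp : ∀ i, 0 ≤ p i) (Φ Ψ : V → ℝ) :
    dirichlet G p (Φ + Ψ) ≤ dirichlet G p Φ + 2 * ∑ i, Ψ i * flux G p Φ i
      + ∑ i, ∑ j ∈ G.neighborFinset i, p i * (Ψ i - Ψ j) ^ 2 := by
  rw [sum_mul_flux]
  simp only [dirichlet, Finset.mul_sum, ← Finset.sum_add_distrib]
  refine Finset.sum_le_sum fun i _ => Finset.sum_le_sum fun j _ => ?_
  have := mul_le_mul_of_nonneg_left (max_add_sq_le (Φ i - Φ j) (Ψ i - Ψ j)) (hp i)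
  simp only [Pi.add_apply, show Φ i + Ψ i - (Φ j + Ψ j) = Φ i - Φ j + (Ψ i - Ψ j) by ring]
  linarith

lemma eq_zero_of_forall_quadratic_nonneg {a b : ℝ} (h : ∀ s : ℝ, 0 ≤ a * s + b * s ^ 2) :
    a = 0 := by
  by_contra ha
  have hpos : 0 < |a| := abs_pos.2 ha
  have h1 := h (-a / (|b| + 1))
  have hb : 0 < |b| + 1 := by positivity
  have h2 : a * (-a / (|b| + 1)) + b * (-a / (|b| + 1)) ^ 2 =
      a ^ 2 * (b - (|b| + 1)) / (|b| + 1) ^ 2 := by field_simp; ring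
  rw [h2] at h1
  have h3 : a ^ 2 * (b - (|b| + 1)) < 0 :=
    mul_neg_of_pos_of_neg (by positivity) (by linarith [le_abs_self b])
  exact absurd h1 (not_le.2 (div_neg_of_neg_of_pos h3 (by positivity)))

/-- The gradient domination inequality for the Dirichlet energy implies quadratic growth with the
same constant. -/
lemma mul_hess_le_dirichlet [Nonempty V] (hG : G.Connected) {W : Matrix V V ℝ}
    (hW : W.PosSemidef) {β : ℝ} (hβ : 0 < β) {p : V → ℝ} (hp : p ∈ posSimplex V) {κ : ℝ}
    (hκ : ∀ Φ, κ * dirichlet G p Φ ≤ ∑ i, flux G p Φ i * hess W β p (flux G p Φ) i)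
    (δ : V → ℝ) (hδ : ∑ i, δ i = 0) :
    κ * ∑ i, δ i * hess W β p δ i ≤ dirichlet G p (hess W β p δ) := by
  have hsymm := posSemidef_isSymm hW
  obtain ⟨m, hm, hmp⟩ := exists_pos_forall_le hp.1
  have hD0 := dirichlet_nonneg G (fun i => (hp.1 i).le)
  set q : (V → ℝ) → ℝ := fun x => ∑ i, x i * hess W β p x i with hq
  have hqc : Continuous q := by
    have := continuous_hess (W := W) (β := β) (p := p)
    fun_prop
  have hqs : ∀ (s : ℝ) x, q (s • x) = s ^ 2 * q x := fun s x => by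
    simp only [hq, hess_smul, Pi.smul_apply, smul_eq_mul, Finset.mul_sum]
    exact Finset.sum_congr rfl fun i _ => by ring
  have hq0 : ∀ x, 0 ≤ q x := hess_nonneg hW hβ hp
  let S : Set (V → ℝ) := {x | ∑ i, x i = 0 ∧ q x = 1}
  have hScpt : IsCompact S := by
    refine (isCompact_closedBall (0 : V → ℝ) √(1 / β)).of_isClosed_subset
      ((isClosed_eq (by fun_prop) continuous_const).inter (isClosed_eq hqc continuous_const)) ?_
    rintro x ⟨-, hx⟩
    rw [mem_closedBall_zero_iff]
    refine Real.le_sqrt_of_sq_le ((norm_sq_le_sum_sq x).trans ?_)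
    rw [le_div_iff₀ hβ, mul_comm, ← hx]
    exact mul_sum_sq_le_hess hW hβ hp x
  have hscale : ∀ x, 0 < q x → ∑ i, x i = 0 → ((√(q x))⁻¹ • x) ∈ S := by
    intro x hx h0
    refine ⟨by simp [← Finset.mul_sum, h0], ?_⟩
    rw [hqs, inv_pow, Real.sq_sqrt hx.le, inv_mul_cancel₀ hx.ne']
  rcases (hq0 δ).eq_or_lt with h0 | h0
  · change κ * q δ ≤ _
    rw [← h0, mul_zero]
    exact hD0 _
  have hc : Continuous fun x => dirichlet G p (hess W β p x) :=
    (continuous_dirichlet G p).comp continuous_hess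
  obtain ⟨e, ⟨he0, he1⟩, hmin⟩ := hScpt.exists_isMinOn ⟨_, hscale δ h0 hδ⟩ hc.continuousOn
  set μ := dirichlet G p (hess W β p e) with hμ
  have hgrow : ∀ x, ∑ i, x i = 0 → μ * q x ≤ dirichlet G p (hess W β p x) := by
    intro x hx
    rcases (hq0 x).eq_or_lt with h | h
    · rw [← h, mul_zero]; exact hD0 _
    · have h1 : μ ≤ dirichlet G p (hess W β p ((√(q x))⁻¹ • x)) := hmin (hscale x h hx)
      rwa [hess_smul, dirichlet_smul G _ _ (by positivity), inv_pow, Real.sq_sqrt h.le,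
        ← div_eq_inv_mul, le_div_iff₀ h] at h1
  -- If `μ = 0`, the Poincaré inequality makes `He` constant, and `e` has zero sum, so `⟨e, He⟩ =
  -- 0`.
  have hμpos : 0 < μ := by
    refine (hD0 _).lt_of_ne fun h => ?_
    obtain ⟨o⟩ := ‹Nonempty V›
    have hconst : ∀ i, hess W β p e i = hess W β p e o := fun i => by
      have := poincare G hG hm hmp (hess W β p e) i o
      rw [← h, mul_zero] at this
      have h2 : (hess W β p e i - hess W β p e o) ^ 2 = 0 :=
        le_antisymm (by nlinarith) (sq_nonneg _)
      exact sub_eq_zero.1 (pow_eq_zero_iff two_ne_zero |>.1 h2)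
    have : q e = 0 := by
      simp only [hq]
      rw [Finset.sum_congr rfl fun i _ => by rw [hconst i], ← Finset.sum_mul, he0, zero_mul]
    linarith
  set X := flux G p (hess W β p e) with hX
  -- The residual of the Euler-Lagrange equation. It has zero sum, so it is an admissible direction,
  -- and the first-order condition tested on it reads `⟨Z, HZ⟩ = 0`.
  set Z := X - μ • e with hZ
  have hZ0 : ∑ i, Z i = 0 := by
    simp [hZ, Finset.sum_sub_distrib, ← Finset.mul_sum, he0, hX, sum_flux]
  have hcrit : ∑ i, Z i * hess W β p Z i = 0 := by
    set R := ∑ i, ∑ j ∈ G.neighborFinset i, p i * (hess W β p Z i - hess W β p Z j) ^ 2 with hR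
    have hfin : (2 * ∑ i, Z i * hess W β p Z i) = 0 := by
      refine eq_zero_of_forall_quadratic_nonneg (b := R - μ * q Z) fun s => ?_
      have h1 := hgrow (e + s • Z) (by
        simp [Finset.sum_add_distrib, ← Finset.mul_sum, he0, hZ0])
      have h2 := dirichlet_add_le G (fun i => (hp.1 i).le) (hess W β p e) (s • hess W β p Z)
      rw [hess_add, hess_smul] at h1
      have h3 : q (e + s • Z) = 1 + 2 * s * ∑ i, e i * hess W β p Z i + s ^ 2 * q Z := by
        rw [← he1]
        have hcomm := sum_mul_hess_comm (p := p) (β := β) hsymm Z e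
        simp only [hq, hess_add, hess_smul, Pi.add_apply, Pi.smul_apply, smul_eq_mul]
        have : ∀ i, (e i + s * Z i) * (hess W β p e i + s * hess W β p Z i) =
            e i * hess W β p e i + s * (e i * hess W β p Z i) + s * (Z i * hess W β p e i)
              + s ^ 2 * (Z i * hess W β p Z i) := fun i => by ring
        simp only [this, Finset.sum_add_distrib, ← Finset.mul_sum, hcomm]
        ring
      have h4 : ∑ i, (s • hess W β p Z) i * flux G p (hess W β p e) i =
          s * ∑ i, X i * hess W β p Z i := by
        rw [Finset.mul_sum]
        exact Finset.sum_congr rfl fun i _ => by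
          simp only [Pi.smul_apply, smul_eq_mul]; ring
      have h5 : ∑ i, ∑ j ∈ G.neighborFinset i,
          p i * ((s • hess W β p Z) i - (s • hess W β p Z) j) ^ 2 = s ^ 2 * R := by
        simp only [hR, Finset.mul_sum, Pi.smul_apply, smul_eq_mul]
        exact Finset.sum_congr rfl fun i _ => Finset.sum_congr rfl fun j _ => by ring
      have h6 : ∑ i, Z i * hess W β p Z i =
          ∑ i, X i * hess W β p Z i - μ * ∑ i, e i * hess W β p Z i := by
        rw [Finset.mul_sum, ← Finset.sum_sub_distrib]
        exact Finset.sum_congr rfl fun i _ => by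
          simp only [hZ, Pi.sub_apply, Pi.smul_apply, smul_eq_mul]; ring
      rw [h4, h5] at h2
      rw [h3] at h1
      rw [h6]
      linarith
    linarith
  have hXe : X = μ • e := sub_eq_zero.1 (eq_zero_of_hess_le_zero hW hβ hp hcrit.le)
  have hκμ : κ ≤ μ := by
    have h1 := hκ (hess W β p e)
    rw [← hX, hXe] at h1
    have h2 : q (μ • e) = μ ^ 2 := by rw [hqs, he1, mul_one]
    have h3 : κ * μ ≤ μ * μ := by rw [← sq, ← h2]; exact h1
    exact le_of_mul_le_mul_right h3 hμpos
  exact (mul_le_mul_of_nonneg_right hκμ (hq0 δ)).trans (hgrow δ hδ)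

end Rate

end DissipationRate

/-! ### Second-order expansions at the Gibbs measure. -/

section LocalExpansion

open Asymptotics

lemma isLittleO_sq_of_hasDerivAt {f f' : ℝ → ℝ} {y : ℝ} (h0 : f y = 0)
    (hf : ∀ᶠ x in 𝓝 y, HasDerivAt f (f' x) x) (hf' : f' =o[𝓝 y] fun x => x - y) :
    f =o[𝓝 y] fun x => (x - y) ^ 2 := by
  refine isLittleO_iff.2 fun c hc => ?_
  obtain ⟨r, hr, hball⟩ := Metric.eventually_nhds_iff.1 (hf.and (isLittleO_iff.1 hf' hc))
  refine Metric.eventually_nhds_iff.2 ⟨r, hr, fun x hx => ?_⟩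
  have hsub : ∀ z ∈ Metric.closedBall y (dist x y), dist z y < r := fun z hz =>
    (Metric.mem_closedBall.1 hz).trans_lt hx
  have := (convex_closedBall y (dist x y)).norm_image_sub_le_of_norm_hasDerivWithin_le
    (f := f) (f' := f') (C := c * dist x y)
    (fun z hz => (hball (hsub z hz)).1.hasDerivWithinAt)
    (fun z hz => (hball (hsub z hz)).2.trans (by
      rw [← dist_eq_norm]
      exact mul_le_mul_of_nonneg_left (Metric.mem_closedBall.1 hz) hc.le))
    (Metric.mem_closedBall_self dist_nonneg) (Metric.mem_closedBall.2 le_rfl)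
  rw [h0, sub_zero] at this
  refine this.trans (le_of_eq ?_)
  rw [norm_pow, dist_eq_norm]; ring

lemma isLittleO_log_sub {y : ℝ} (hy : 0 < y) :
    (fun x => Real.log x - Real.log y - (x - y) / y) =o[𝓝 y] fun x => x - y := by
  have := (Real.hasDerivAt_log hy.ne').isLittleO
  simpa [div_eq_mul_inv] using this

/-- The derivative of this remainder is exactly the first-order remainder of the logarithm. -/
lemma isLittleO_relativeEntropy_sub {y : ℝ} (hy : 0 < y) :
    (fun x => x * Real.log (x / y) - x + y - (x - y) ^ 2 / (2 * y)) =o[𝓝 y]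
      fun x => (x - y) ^ 2 := by
  refine isLittleO_sq_of_hasDerivAt (by simp [hy.ne']) ?_ (isLittleO_log_sub hy)
  filter_upwards [lt_mem_nhds hy] with x hx
  have h1 : HasDerivAt (fun x => x / y) (1 / y) x := (hasDerivAt_id x).div_const y
  have h2 := (hasDerivAt_id x).mul (h1.log (div_pos hx hy).ne')
  have h3 := (((hasDerivAt_id x).sub_const y).pow 2).div_const (2 * y)
  refine (((h2.sub (hasDerivAt_id x)).add_const y).sub h3).congr_deriv ?_
  simp only [id, Real.log_div hx.ne' hy.ne']
  field_simp
  norm_num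
  ring

lemma isBigO_apply_sub (p : V → ℝ) (l : Filter (V → ℝ)) (i : V) :
    (fun ρ : V → ℝ => ρ i - p i) =O[l] fun ρ => ρ - p :=
  IsBigO.of_bound 1 (Eventually.of_forall fun ρ => by
    simpa using norm_le_pi_norm (ρ - p) i)

lemma tendsto_apply (p : V → ℝ) (i : V) : Tendsto (fun ρ : V → ℝ => ρ i) (𝓝 p) (𝓝 (p i)) :=
  (continuous_apply i).tendsto p

lemma isBigO_hess (W : Matrix V V ℝ) (β : ℝ) (p : V → ℝ) (l : Filter (V → ℝ)) (i : V) :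
    (fun ρ : V → ℝ => hess W β p (ρ - p) i) =O[l] fun ρ => ρ - p := by
  unfold hess
  refine IsBigO.add (IsBigO.fun_sum fun j _ => (isBigO_apply_sub p l j).const_mul_left _) ?_
  simp only [div_eq_mul_inv, mul_comm _ (p i)⁻¹]
  exact ((isBigO_apply_sub p l i).const_mul_left _).const_mul_left _

lemma isLittleO_potential (v : V → ℝ) (W : Matrix V V ℝ) (β : ℝ) {p : V → ℝ}
    (hp : ∀ i, 0 < p i) (i : V) :
    (fun ρ => potential v W β ρ i - potential v W β p i - hess W β p (ρ - p) i) =o[𝓝 p]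
      fun ρ => ρ - p := by
  have h1 := ((isLittleO_log_sub (hp i)).comp_tendsto (tendsto_apply p i)).trans_isBigO
    (isBigO_apply_sub p _ i)
  refine (h1.const_mul_left β).congr_left fun ρ => ?_
  simp only [potential, hess, Pi.sub_apply, mul_sub, Finset.sum_sub_distrib, Function.comp]
  ring

/-- Only the entropy leaves an error. The filter is restricted to the simplex because the linear
term vanishes only between densities of equal mass. -/
lemma isLittleO_freeEnergy {v : V → ℝ} {W : Matrix V V ℝ} (hW : W.IsSymm) (β : ℝ) {p : V → ℝ}
    {c : ℝ} (hp : p ∈ posSimplex V) (hc : ∀ i, potential v W β p i = c) :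
    (fun ρ => freeEnergy v W β ρ - freeEnergy v W β p
      - 1 / 2 * ∑ i, (ρ - p) i * hess W β p (ρ - p) i) =o[𝓝[posSimplex V] p]
      fun ρ => ‖ρ - p‖ ^ 2 := by
  have h1 : (fun ρ : V → ℝ => β * ∑ i, (ρ i * Real.log (ρ i / p i) - ρ i + p i
      - (ρ i - p i) ^ 2 / (2 * p i))) =o[𝓝 p] fun ρ => ‖ρ - p‖ ^ 2 := by
    refine IsLittleO.const_mul_left (IsLittleO.fun_sum fun i _ => ?_) _
    refine ((isLittleO_relativeEntropy_sub (hp.1 i)).comp_tendsto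
      (tendsto_apply p i)).trans_isBigO ?_
    exact (isBigO_apply_sub p (𝓝 p) i).norm_right.pow 2
  refine (h1.mono nhdsWithin_le_nhds).congr' ?_ EventuallyEq.rfl
  filter_upwards [self_mem_nhdsWithin] with ρ hρ
  rw [freeEnergy_sub hW β hρ.1 hp.1, sum_const_mul_sub hc hρ hp]
  simp only [hess, mul_add, Finset.sum_add_distrib, Pi.sub_apply, Finset.sum_sub_distrib]
  have : ∑ i, (ρ i - p i) * (β * ((ρ i - p i) / p i)) =
      2 * (β * ∑ i, (ρ i - p i) ^ 2 / (2 * p i)) := by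
    simp only [Finset.mul_sum]
    refine Finset.sum_congr rfl fun i _ => ?_
    have := (hp.1 i).ne'
    field_simp
  rw [this]
  ring

variable (G : SimpleGraph V) [DecidableRel G.Adj]

/-- The positive part is not differentiable, but it is 1-Lipschitz, so `a₊² - b₊² = (a₊ - b₊)(a₊ +
b₊)` is small of second order once `a - b` is `o(|ρ - p|)`. -/
lemma isLittleO_dirichlet (v : V → ℝ) (W : Matrix V V ℝ) (β : ℝ) {p : V → ℝ} {c : ℝ}
    (hp : ∀ i, 0 < p i) (hc : ∀ i, potential v W β p i = c) :
    (fun ρ => dirichlet G ρ (potential v W β ρ) - dirichlet G p (hess W β p (ρ - p))) =o[𝓝 p]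
      fun ρ => ‖ρ - p‖ ^ 2 := by
  have hterm : ∀ i j, (fun ρ : V → ℝ =>
      ρ i * max (potential v W β ρ i - potential v W β ρ j) 0 ^ 2
      - p i * max (hess W β p (ρ - p) i - hess W β p (ρ - p) j) 0 ^ 2) =o[𝓝 p]
      fun ρ => ‖ρ - p‖ ^ 2 := by
    intro i j
    set a : (V → ℝ) → ℝ := fun ρ => potential v W β ρ i - potential v W β ρ j with ha
    set b : (V → ℝ) → ℝ := fun ρ => hess W β p (ρ - p) i - hess W β p (ρ - p) j with hb
    have hab : (fun ρ => a ρ - b ρ) =o[𝓝 p] fun ρ => ρ - p := by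
      refine ((isLittleO_potential v W β hp i).sub (isLittleO_potential v W β hp j)).congr_left
        fun ρ => ?_
      simp only [ha, hb, hc]; ring
    have hbO : b =O[𝓝 p] fun ρ => ρ - p := (isBigO_hess W β p _ i).sub (isBigO_hess W β p _ j)
    have haO : a =O[𝓝 p] fun ρ => ρ - p := by
      simpa using hab.isBigO.add hbO
    have hmax : ∀ {f : (V → ℝ) → ℝ}, f =O[𝓝 p] (fun ρ => ρ - p) →
        (fun ρ => max (f ρ) 0) =O[𝓝 p] fun ρ => ρ - p := fun {f} hf =>
      (IsBigO.of_bound 1 (Eventually.of_forall fun ρ => by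
        rw [Real.norm_eq_abs, Real.norm_eq_abs, one_mul]
        simpa using abs_max_sub_max_le_abs (f ρ) 0 0)).trans hf
    have hmab : (fun ρ => max (a ρ) 0 - max (b ρ) 0) =o[𝓝 p] fun ρ => ρ - p :=
      (IsBigO.of_bound 1 (Eventually.of_forall fun ρ => by
        rw [Real.norm_eq_abs, Real.norm_eq_abs, one_mul]
        exact abs_max_sub_max_le_abs (a ρ) (b ρ) 0)).trans_isLittleO hab
    have hρ : (fun ρ : V → ℝ => ρ i - p i) =o[𝓝 p] fun _ => (1 : ℝ) := by
      rw [isLittleO_one_iff]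
      simpa using (tendsto_apply p i).sub_const (p i)
    have h1 : (fun ρ => (ρ i - p i) * max (a ρ) 0 ^ 2) =o[𝓝 p] fun ρ => ‖ρ - p‖ ^ 2 := by
      simpa using hρ.mul_isBigO ((hmax haO).norm_right.pow 2)
    have h2 : (fun ρ => (max (a ρ) 0 - max (b ρ) 0) * (max (a ρ) 0 + max (b ρ) 0)) =o[𝓝 p]
        fun ρ => ‖ρ - p‖ ^ 2 := by
      simpa [sq] using hmab.norm_right.mul_isBigO ((hmax haO).add (hmax hbO)).norm_right
    refine (h1.add (h2.const_mul_left (p i))).congr_left fun ρ => ?_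
    ring
  unfold dirichlet
  simp only [← Finset.sum_sub_distrib]
  exact IsLittleO.fun_sum fun i _ => IsLittleO.fun_sum fun j _ => hterm i j

/-- Local entropy-dissipation inequality with the sharp constant. -/
lemma eventually_entropy_dissipation {v : V → ℝ} {W : Matrix V V ℝ} (hW : W.PosSemidef) {β : ℝ}
    (hβ : 0 < β) {p : V → ℝ} {c : ℝ} (hp : p ∈ posSimplex V)
    (hc : ∀ i, potential v W β p i = c) {κ : ℝ}
    (hκ : ∀ δ, ∑ i, δ i = 0 → κ * ∑ i, δ i * hess W β p δ i ≤ dirichlet G p (hess W β p δ))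
    {η : ℝ} (hη : 0 < η) :
    ∀ᶠ ρ in 𝓝[posSimplex V] p, 2 * (κ - η) * (freeEnergy v W β ρ - freeEnergy v W β p) ≤
      dirichlet G ρ (potential v W β ρ) := by
  have h1 := ((isLittleO_freeEnergy (posSemidef_isSymm hW) β hp hc).const_mul_left
    (2 * (κ - η)))
  have h2 := (isLittleO_dirichlet G v W β hp.1 hc).mono
    (nhdsWithin_le_nhds (s := posSimplex V))
  -- The tolerance `η * β` is what the spare `η ⟨δ, Hδ⟩ ≥ η β ‖δ‖²` absorbs.
  have h3 := isLittleO_iff.1 (h2.sub h1) (mul_pos hη hβ)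
  filter_upwards [h3, self_mem_nhdsWithin] with ρ h hρ
  rw [Real.norm_eq_abs, Real.norm_eq_abs, abs_of_nonneg (sq_nonneg ‖ρ - p‖)] at h
  have h4 := (abs_le.1 h).1
  have h5 := hκ (ρ - p) (by simp [Finset.sum_sub_distrib, hρ.2, hp.2])
  have h6 : β * ‖ρ - p‖ ^ 2 ≤ ∑ i, (ρ - p) i * hess W β p (ρ - p) i :=
    (mul_le_mul_of_nonneg_left (norm_sq_le_sum_sq _) hβ.le).trans
      (mul_sum_sq_le_hess hW hβ hp _)
  nlinarith [mul_le_mul_of_nonneg_left h6 hη.le]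

end LocalExpansion

/-! ### Global existence and uniqueness of solutions. -/

section WellPosedness

open scoped NNReal

section BoundedLipschitz

/-- Real functions that are bounded and Lipschitz on a set. -/
def BddLipOn {E : Type*} [PseudoMetricSpace E] (f : E → ℝ) (s : Set E) : Prop :=
  ∃ B ≥ 0, ∃ L ≥ 0, ∀ x ∈ s, |f x| ≤ B ∧ ∀ y ∈ s, |f x - f y| ≤ L * dist x y

namespace BddLipOn

variable {E : Type*} [PseudoMetricSpace E] {f g : E → ℝ} {s : Set E}

lemma const (c : ℝ) : BddLipOn (fun _ : E => c) s :=
  ⟨|c|, abs_nonneg _, 0, le_rfl, fun x _ => ⟨le_rfl, fun y _ => by simp⟩⟩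

lemma add (hf : BddLipOn f s) (hg : BddLipOn g s) : BddLipOn (fun x => f x + g x) s := by
  obtain ⟨B, hB, L, hL, h⟩ := hf
  obtain ⟨B', hB', L', hL', h'⟩ := hg
  refine ⟨B + B', by positivity, L + L', by positivity, fun x hx => ⟨?_, fun y hy => ?_⟩⟩
  · exact (abs_add_le _ _).trans (add_le_add (h x hx).1 (h' x hx).1)
  · rw [add_sub_add_comm, add_mul]
    exact (abs_add_le _ _).trans (add_le_add ((h x hx).2 y hy) ((h' x hx).2 y hy))

lemma mul (hf : BddLipOn f s) (hg : BddLipOn g s) : BddLipOn (fun x => f x * g x) s := by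
  obtain ⟨B, hB, L, hL, h⟩ := hf
  obtain ⟨B', hB', L', hL', h'⟩ := hg
  refine ⟨B * B', by positivity, B * L' + L * B', by positivity,
    fun x hx => ⟨?_, fun y hy => ?_⟩⟩
  · rw [abs_mul]
    exact mul_le_mul (h x hx).1 (h' x hx).1 (abs_nonneg _) hB
  · have e : f x * g x - f y * g y = f x * (g x - g y) + (f x - f y) * g y := by ring
    rw [e]
    refine (abs_add_le _ _).trans ?_
    rw [abs_mul, abs_mul, add_mul]
    refine add_le_add ?_ ?_
    · rw [mul_assoc]
      exact mul_le_mul (h x hx).1 ((h' x hx).2 y hy) (abs_nonneg _) hB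
    · rw [mul_right_comm]
      exact mul_le_mul ((h x hx).2 y hy) (h' y hy).1 (abs_nonneg _) (by positivity)

lemma sub (hf : BddLipOn f s) (hg : BddLipOn g s) : BddLipOn (fun x => f x - g x) s := by
  simpa [sub_eq_add_neg] using hf.add ((const (-1)).mul hg)

lemma sum {ι : Type*} (t : Finset ι) {f : ι → E → ℝ} (hf : ∀ i, BddLipOn (f i) s) :
    BddLipOn (fun x => ∑ i ∈ t, f i x) s := by
  classical
  induction t using Finset.induction_on with
  | empty => simpa using const 0
  | insert a t ha ih => simpa [Finset.sum_insert ha] using (hf a).add ih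

lemma max_zero (hf : BddLipOn f s) : BddLipOn (fun x => max (f x) 0) s := by
  obtain ⟨B, hB, L, hL, h⟩ := hf
  refine ⟨B, hB, L, hL, fun x hx => ⟨?_, fun y hy => ?_⟩⟩
  · have := abs_max_sub_max_le_abs (f x) 0 0
    simp only [max_self, sub_zero] at this
    exact this.trans (h x hx).1
  · exact (abs_max_sub_max_le_abs _ _ _).trans ((h x hx).2 y hy)

end BddLipOn

end BoundedLipschitz

/-- The box `[ε, 1]^V`. -/
def box (V : Type*) (ε : ℝ) : Set (V → ℝ) := {ρ | ∀ i, ε ≤ ρ i ∧ ρ i ≤ 1}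

lemma bddLipOn_apply {ε : ℝ} (hε : 0 < ε) (i : V) :
    BddLipOn (fun ρ : V → ℝ => ρ i) (box V ε) := by
  refine ⟨1, zero_le_one, 1, zero_le_one, fun x hx => ⟨?_, fun y _ => ?_⟩⟩
  · rw [abs_of_pos (hε.trans_le (hx i).1)]; exact (hx i).2
  · rw [one_mul, ← Real.dist_eq]; exact dist_le_pi_dist x y i

lemma log_sub_log_le {ε x y : ℝ} (hε : 0 < ε) (hx : ε ≤ x) (hy : ε ≤ y) :
    Real.log x - Real.log y ≤ 1 / ε * |x - y| := by
  have hx0 := hε.trans_le hx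
  have hy0 := hε.trans_le hy
  rw [← Real.log_div hx0.ne' hy0.ne']
  calc Real.log (x / y) ≤ x / y - 1 := Real.log_le_sub_one_of_pos (by positivity)
    _ = 1 / y * (x - y) := by field_simp
    _ ≤ 1 / y * |x - y| := by gcongr; exact le_abs_self _
    _ ≤ 1 / ε * |x - y| := by gcongr

lemma bddLipOn_log_apply {ε : ℝ} (hε : 0 < ε) (i : V) :
    BddLipOn (fun ρ : V → ℝ => Real.log (ρ i)) (box V ε) := by
  refine ⟨|Real.log ε|, abs_nonneg _, 1 / ε, by positivity, fun x hx => ⟨?_, fun y hy => ?_⟩⟩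
  · have h1 := Real.log_nonpos (hε.trans_le (hx i).1).le (hx i).2
    have h2 := Real.log_le_log hε (hx i).1
    rw [abs_of_nonpos h1, abs_of_nonpos (h2.trans h1)]
    linarith
  · have h1 := log_sub_log_le hε (hx i).1 (hy i).1
    have h2 := log_sub_log_le hε (hy i).1 (hx i).1
    rw [abs_sub_comm] at h2
    refine (abs_sub_le_iff.2 ⟨h1, h2⟩).trans ?_
    rw [← Real.dist_eq]
    gcongr
    exact dist_le_pi_dist x y i

lemma bddLipOn_potential (v : V → ℝ) (W : Matrix V V ℝ) (β : ℝ) {ε : ℝ} (hε : 0 < ε) (i : V) :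
    BddLipOn (fun ρ => potential v W β ρ i) (box V ε) := by
  unfold potential
  exact ((BddLipOn.const _).add (BddLipOn.sum _ fun j =>
    (BddLipOn.const _).mul (bddLipOn_apply hε j))).add
      ((BddLipOn.const _).mul ((bddLipOn_log_apply hε i).add (BddLipOn.const _)))

variable (G : SimpleGraph V) [DecidableRel G.Adj]

/-- The explicit form of the vector field at positive densities. -/
def field (v : V → ℝ) (W : Matrix V V ℝ) (β Δx : ℝ) (ρ : V → ℝ) (i : V) : ℝ :=
  -(1 / Δx ^ 2) * flux G ρ (potential v W β ρ) i

lemma bddLipOn_field (v : V → ℝ) (W : Matrix V V ℝ) (β Δx : ℝ) {ε : ℝ} (hε : 0 < ε) (i : V) :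
    BddLipOn (fun ρ => field G v W β Δx ρ i) (box V ε) := by
  unfold field flux
  have h := fun i j => (bddLipOn_potential v W β hε i).sub (bddLipOn_potential v W β hε j)
  exact (BddLipOn.const _).mul ((BddLipOn.sum _ fun j =>
    (bddLipOn_apply hε i).mul (h i j).max_zero).sub
      (BddLipOn.sum _ fun j => (bddLipOn_apply hε j).mul (h j i).max_zero))

lemma exists_lipschitz_field (v : V → ℝ) (W : Matrix V V ℝ) (β Δx : ℝ) {ε : ℝ} (hε : 0 < ε) :
    ∃ K L : ℝ≥0, LipschitzOnWith K (field G v W β Δx) (box V ε) ∧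
      ∀ ρ ∈ box V ε, ‖field G v W β Δx ρ‖ ≤ L := by
  choose B hB L hL h using bddLipOn_field G v W β Δx hε
  have hBs : ∀ i, B i ≤ ∑ i, B i := fun i =>
    Finset.single_le_sum (fun i _ => hB i) (Finset.mem_univ i)
  have hLs : ∀ i, L i ≤ ∑ i, L i := fun i =>
    Finset.single_le_sum (fun i _ => hL i) (Finset.mem_univ i)
  have hB0 : 0 ≤ ∑ i, B i := Finset.sum_nonneg fun i _ => hB i
  have hL0 : 0 ≤ ∑ i, L i := Finset.sum_nonneg fun i _ => hL i
  refine ⟨(∑ i, L i).toNNReal, (∑ i, B i).toNNReal, ?_, fun ρ hρ => ?_⟩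
  · refine LipschitzOnWith.of_dist_le_mul fun x hx y hy => ?_
    rw [Real.coe_toNNReal _ hL0]
    refine (dist_pi_le_iff (by positivity)).2 fun i => ?_
    rw [Real.dist_eq]
    refine ((h i x hx).2 y hy).trans ?_
    gcongr
    exact hLs i
  · rw [Real.coe_toNNReal _ hB0]
    exact (pi_norm_le_iff_of_nonneg hB0).2 fun i => ((h i ρ hρ).1).trans (hBs i)

/-- Coordinatewise projection onto the box. -/
def clamp {ε : ℝ} (h : ε ≤ 1) (ρ : V → ℝ) (i : V) : ℝ := projIcc ε 1 h (ρ i)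

lemma clamp_mem {ε : ℝ} (h : ε ≤ 1) (ρ : V → ℝ) : clamp h ρ ∈ box V ε := fun i =>
  (projIcc ε 1 h (ρ i)).2

lemma clamp_of_mem {ε : ℝ} (h : ε ≤ 1) {ρ : V → ℝ} (hρ : ρ ∈ box V ε) : clamp h ρ = ρ := by
  ext i
  rw [clamp, projIcc_of_mem h (hρ i)]

lemma lipschitzWith_clamp {ε : ℝ} (h : ε ≤ 1) : LipschitzWith 1 (clamp (V := V) h) := by
  refine LipschitzWith.of_dist_le_mul fun x y => ?_
  rw [NNReal.coe_one, one_mul]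
  refine (dist_pi_le_iff dist_nonneg).2 fun i => ?_
  have := (LipschitzWith.projIcc h).dist_le_mul (x i) (y i)
  rw [NNReal.coe_one, one_mul] at this
  exact this.trans (dist_le_pi_dist x y i)

/-- Global existence on a compact time interval for bounded Lipschitz fields. -/
lemma exists_solution_Icc {E : Type*} [NormedAddCommGroup E] [NormedSpace ℝ E] [CompleteSpace E]
    {f : E → E} {K L : ℝ≥0} (hf : LipschitzWith K f) (hL : ∀ x, ‖f x‖ ≤ L) (x₀ : E) {T : ℝ}
    (hT : 0 ≤ T) : ∃ α : ℝ → E, α 0 = x₀ ∧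
      ∀ t ∈ Icc 0 T, HasDerivWithinAt α (f (α t)) (Icc 0 T) t := by
  -- A ball of radius `L * T` cannot be left before time `T`, so one application covers the whole
  -- interval.
  have hPL : IsPicardLindelof (fun _ : ℝ => f) (tmin := 0) (tmax := T) ⟨0, le_rfl, hT⟩ x₀
      (L * T.toNNReal) 0 L K :=
    { lipschitzOnWith := fun t _ => hf.lipschitzOnWith
      continuousOn := fun x _ => continuousOn_const
      norm_le := fun t _ x _ => hL x
      mul_max_le := by simp [hT] }
  exact hPL.exists_eq_forall_mem_Icc_hasDerivWithinAt₀

/-- First-exit argument: the minimal coordinate of a curve stays above an exponential barrier. -/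
lemma barrier_lt {α : ℝ → V → ℝ} {g : ℝ → V → ℝ} {T m C : ℝ}
    (hα : ∀ t ∈ Icc 0 T, HasDerivWithinAt α (g t) (Icc 0 T) t) (h0 : ∀ i, m < α 0 i)
    (hg : ∀ t ∈ Icc 0 T, (∀ j, m * Real.exp (-C * t) ≤ α t j) → ∀ i,
      α t i = m * Real.exp (-C * t) → -C * (m * Real.exp (-C * t)) < g t i) :
    ∀ t ∈ Icc 0 T, ∀ i, m * Real.exp (-C * t) < α t i := by
  set b : ℝ → ℝ := fun t => m * Real.exp (-C * t) with hb
  have hbd : ∀ t, HasDerivAt b (-C * b t) t := fun t => by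
    have h1 : HasDerivAt (fun t : ℝ => -C * t) (-C) t := by
      simpa using (hasDerivAt_id t).const_mul (-C)
    refine (h1.exp.const_mul m).congr_deriv ?_
    simp only [hb]; ring
  have hbc : Continuous b := by fun_prop
  have hαi : ∀ i, ContinuousOn (fun t => α t i) (Icc 0 T) := fun i t ht =>
    (hasDerivWithinAt_pi.1 (hα t ht) i).continuousWithinAt
  by_contra! hcon
  obtain ⟨t₁, ht₁, i₁, hi₁⟩ := hcon
  set S : Set ℝ := ⋃ i, {t ∈ Icc 0 T | α t i ≤ b t} with hS
  have hScl : IsClosed S := isClosed_iUnion_of_finite fun i =>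
    isClosed_Icc.isClosed_le (hαi i) hbc.continuousOn
  have hSne : S.Nonempty := ⟨t₁, mem_iUnion.2 ⟨i₁, ht₁, hi₁⟩⟩
  have hSbd : BddBelow S := ⟨0, fun t ht => by
    obtain ⟨i, hi, -⟩ := mem_iUnion.1 ht; exact hi.1⟩
  set τ := sInf S with hτ
  obtain ⟨i, hτT, hi⟩ := mem_iUnion.1 (hScl.csInf_mem hSne hSbd)
  have hτ0 : 0 < τ := by
    refine hτT.1.lt_of_ne fun h => ?_
    have h2 := h0 i
    have h3 : α τ i ≤ b τ := hi
    rw [show τ = 0 from h.symm] at h3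
    simp only [hb, mul_zero, Real.exp_zero, mul_one] at h3
    linarith
  have hbefore : ∀ t ∈ Ico 0 τ, ∀ j, b t < α t j := by
    intro t ht j
    by_contra! hle
    exact not_lt.2 (csInf_le hSbd (mem_iUnion.2 ⟨j, ⟨ht.1, ht.2.le.trans hτT.2⟩, hle⟩)) ht.2
  have hsub : Ico 0 τ ⊆ Icc 0 T := fun t ht => ⟨ht.1, ht.2.le.trans hτT.2⟩
  have hne : (𝓝[Ico 0 τ] τ).NeBot := right_nhdsWithin_Ico_neBot hτ0
  have hge : ∀ j, b τ ≤ α τ j := fun j =>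
    le_of_tendsto_of_tendsto (hbc.continuousWithinAt (s := Ico 0 τ))
      ((hαi j τ hτT).mono hsub) (eventually_mem_nhdsWithin.mono fun t ht => (hbefore t ht j).le)
  have heq : α τ i = b τ := le_antisymm hi (hge i)
  have hlt := hg τ hτT hge i heq
  have hd : HasDerivWithinAt (fun t => α t i - b t) (g τ i - -C * b τ) (Ico 0 τ) τ :=
    ((hasDerivWithinAt_pi.1 (hα τ hτT) i).mono hsub).sub (hbd τ).hasDerivWithinAt
  -- At the first contact time the left difference quotients of `α i - b` are nonpositive, against
  -- the strict inequality in `hg`.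
  have hslope := (hasDerivWithinAt_iff_tendsto_slope' (by simp)).1 hd
  have : g τ i - -C * b τ ≤ 0 := by
    refine le_of_tendsto hslope (eventually_mem_nhdsWithin.mono fun t ht => ?_)
    rw [slope_def_field, heq, sub_self, sub_zero]
    exact div_nonpos_of_nonneg_of_nonpos (by linarith [hbefore t ht i]) (by linarith [ht.2])
  simp only [hb] at this
  linarith

lemma sum_field (v : V → ℝ) (W : Matrix V V ℝ) (β Δx : ℝ) (ρ : V → ℝ) :
    ∑ i, field G v W β Δx ρ i = 0 := by
  simp only [field, ← Finset.mul_sum, sum_flux, mul_zero]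

/-- At a vertex of minimal density the mass decreases at most at a linear rate. -/
lemma exists_field_ge (v : V → ℝ) (W : Matrix V V ℝ) {β : ℝ} (hβ : 0 < β) (Δx : ℝ) :
    ∃ C > 0, ∀ ρ ∈ posSimplex V, ∀ i, (∀ j, ρ i ≤ ρ j) → -C * ρ i < field G v W β Δx ρ i := by
  obtain ⟨B, hB, hbd⟩ := exists_abs_potential_le v W β
  -- Where density is minimal so is its logarithm, which leaves outgoing potential drops of at most
  -- `2 * B`. The added `1` makes the inequality strict.
  refine ⟨1 / Δx ^ 2 * (Fintype.card V * (2 * B)) + 1, by positivity, fun ρ hρ i hi => ?_⟩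
  have hpot : ∀ j, max (potential v W β ρ i - potential v W β ρ j) 0 ≤ 2 * B := by
    intro j
    refine max_le ?_ (by positivity)
    have h1 := abs_le.1 (hbd ρ hρ i)
    have h2 := abs_le.1 (hbd ρ hρ j)
    have h3 : β * Real.log (ρ i) ≤ β * Real.log (ρ j) :=
      mul_le_mul_of_nonneg_left (Real.log_le_log (hρ.1 i) (hi j)) hβ.le
    linarith
  have h1 : ∑ j ∈ G.neighborFinset i, ρ i * max (potential v W β ρ i - potential v W β ρ j) 0 ≤
      Fintype.card V * (ρ i * (2 * B)) := by
    refine (Finset.sum_le_card_nsmul _ _ _ fun j _ =>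
      mul_le_mul_of_nonneg_left (hpot j) (hρ.1 i).le).trans ?_
    rw [nsmul_eq_mul]
    have := (hρ.1 i).le
    gcongr
    exact Finset.card_le_univ _
  have h2 : 0 ≤ ∑ j ∈ G.neighborFinset i,
      ρ j * max (potential v W β ρ j - potential v W β ρ i) 0 :=
    Finset.sum_nonneg fun j _ => mul_nonneg (hρ.1 j).le (le_max_right _ _)
  have h3 : flux G ρ (potential v W β ρ) i ≤ Fintype.card V * (ρ i * (2 * B)) := by
    rw [flux]; linarith
  have h4 : 1 / Δx ^ 2 * flux G ρ (potential v W β ρ) i ≤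
      1 / Δx ^ 2 * (Fintype.card V * (ρ i * (2 * B))) :=
    mul_le_mul_of_nonneg_left h3 (by positivity)
  rw [field]
  have := hρ.1 i
  linarith

lemma hasDerivWithinAt_Ici_of_Icc {E : Type*} [NormedAddCommGroup E] [NormedSpace ℝ E]
    {α : ℝ → E} {α' : E} {T t : ℝ} (ht : t ∈ Ico 0 T) (h : HasDerivWithinAt α α' (Icc 0 T) t) :
    HasDerivWithinAt α α' (Ici t) t :=
  h.mono_of_mem_nhdsWithin (Icc_mem_nhdsGE_of_mem ht)

/-- Solutions on `[0, T]` with positive initial data. -/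
lemma exists_field_solution_Icc [Nonempty V] (v : V → ℝ) (W : Matrix V V ℝ) {β : ℝ} (hβ : 0 < β)
    (Δx : ℝ) {ρ₀ : V → ℝ} (hρ₀ : ρ₀ ∈ posSimplex V) {T : ℝ} (hT : 0 ≤ T) :
    ∃ α : ℝ → V → ℝ, α 0 = ρ₀ ∧ ∀ t ∈ Icc 0 T, α t ∈ posSimplex V ∧
      HasDerivWithinAt α (field G v W β Δx (α t)) (Icc 0 T) t := by
  obtain ⟨C, hC, hfield⟩ := exists_field_ge G v W hβ Δx
  obtain ⟨m', hm', hmin⟩ := exists_pos_forall_le hρ₀.1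
  set m := m' / 2
  have hm : 0 < m := half_pos hm'
  have hmlt : ∀ i, m < ρ₀ i := fun i => (half_lt_self hm').trans_le (hmin i)
  -- The barrier at the final time: above the barrier, clamping from below at `ε` is inactive
  -- throughout `[0, T]`.
  set ε := m * Real.exp (-C * T) with hε
  have hε0 : 0 < ε := by positivity
  have hεb : ∀ t ∈ Icc 0 T, ε ≤ m * Real.exp (-C * t) := fun t ht => by
    have h : -C * T ≤ -C * t := mul_le_mul_of_nonpos_left ht.2 (by linarith)
    exact mul_le_mul_of_nonneg_left (Real.exp_le_exp.2 h) hm.le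
  have hε1 : ε ≤ 1 := by
    obtain ⟨i⟩ := ‹Nonempty V›
    refine ((hεb 0 ⟨le_rfl, hT⟩).trans ?_).trans (posSimplex_le_one hρ₀ i)
    simpa using (hmlt i).le
  obtain ⟨K, L, hK, hL⟩ := exists_lipschitz_field G v W β Δx hε0
  have hlip : LipschitzWith (K * 1) (field G v W β Δx ∘ clamp hε1) :=
    lipschitzOnWith_univ.1 (hK.comp (lipschitzWith_clamp hε1).lipschitzOnWith
      fun ρ _ => clamp_mem hε1 ρ)
  obtain ⟨α, hα0, hα⟩ := exists_solution_Icc hlip (fun ρ => hL _ (clamp_mem hε1 ρ)) ρ₀ hT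
  -- The clamped field also has zero sum, so mass is conserved before positivity is known; with
  -- positivity it yields the upper bound `1`.
  have hsum : ∀ t ∈ Icc 0 T, ∑ i, α t i = 1 := by
    have hd : ∀ t ∈ Icc 0 T, HasDerivWithinAt (fun t => ∑ i, α t i) 0 (Icc 0 T) t := by
      intro t ht
      have := HasDerivWithinAt.fun_sum (u := Finset.univ)
        fun i _ => hasDerivWithinAt_pi.1 (hα t ht) i
      simpa [sum_field] using this
    intro t ht
    have := constant_of_has_deriv_right_zero (fun t ht => (hd t ht).continuousWithinAt)
      (fun t ht => hasDerivWithinAt_Ici_of_Icc ht (hd t (Ico_subset_Icc_self ht))) t ht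
    rw [this, hα0, hρ₀.2]
  have hmem : ∀ t ∈ Icc 0 T, (∀ j, m * Real.exp (-C * t) ≤ α t j) →
      α t ∈ posSimplex V ∧ clamp hε1 (α t) = α t := by
    intro t ht h
    have hpos : α t ∈ posSimplex V :=
      ⟨fun j => lt_of_lt_of_le (by positivity) (h j), hsum t ht⟩
    exact ⟨hpos, clamp_of_mem hε1 fun j => ⟨(hεb t ht).trans (h j), posSimplex_le_one hpos j⟩⟩
  have hbar := barrier_lt (C := C) hα (by rwa [hα0]) (by
    intro t ht hge i hi
    obtain ⟨h1, h2⟩ := hmem t ht hge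
    rw [Function.comp_apply, h2, ← hi]
    exact hfield _ h1 i fun j => hi ▸ hge j)
  refine ⟨α, hα0, fun t ht => ?_⟩
  obtain ⟨h1, h2⟩ := hmem t ht fun j => (hbar t ht j).le
  refine ⟨h1, ?_⟩
  have := hα t ht
  rwa [Function.comp_apply, h2] at this

lemma exists_mem_box {α : ℝ → V → ℝ} {T : ℝ} (hT : 0 ≤ T) (hα : ContinuousOn α (Icc 0 T))
    (hpos : ∀ t ∈ Icc 0 T, α t ∈ posSimplex V) [Nonempty V] :
    ∃ ε > 0, ∀ t ∈ Icc 0 T, α t ∈ box V ε := by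
  have h : ∀ i, ∃ e > 0, ∀ t ∈ Icc 0 T, e ≤ α t i := fun i => by
    obtain ⟨s, hs, hmin⟩ := isCompact_Icc.exists_isMinOn (nonempty_Icc.2 hT)
      ((continuous_apply i).comp_continuousOn hα)
    exact ⟨α s i, (hpos s hs).1 i, fun t ht => hmin ht⟩
  choose e he hle using h
  obtain ⟨ε, hε, hεe⟩ := exists_pos_forall_le he
  exact ⟨ε, hε, fun t ht i => ⟨(hεe i).trans (hle i t ht), posSimplex_le_one (hpos t ht) i⟩⟩

/-- By compactness both trajectories lie in one box, where the field is Lipschitz. -/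
lemma eqOn_field_solution [Nonempty V] (v : V → ℝ) (W : Matrix V V ℝ) (β Δx : ℝ) {T : ℝ}
    (hT : 0 ≤ T) {α γ : ℝ → V → ℝ}
    (hα : ∀ t ∈ Icc 0 T, α t ∈ posSimplex V ∧
      HasDerivWithinAt α (field G v W β Δx (α t)) (Icc 0 T) t)
    (hγ : ∀ t ∈ Icc 0 T, γ t ∈ posSimplex V ∧
      HasDerivWithinAt γ (field G v W β Δx (γ t)) (Icc 0 T) t)
    (h0 : α 0 = γ 0) : EqOn α γ (Icc 0 T) := by
  have hαc : ContinuousOn α (Icc 0 T) := fun t ht => (hα t ht).2.continuousWithinAt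
  have hγc : ContinuousOn γ (Icc 0 T) := fun t ht => (hγ t ht).2.continuousWithinAt
  obtain ⟨ε₁, hε₁, h₁⟩ := exists_mem_box hT hαc fun t ht => (hα t ht).1
  obtain ⟨ε₂, hε₂, h₂⟩ := exists_mem_box hT hγc fun t ht => (hγ t ht).1
  obtain ⟨K, -, hK, -⟩ := exists_lipschitz_field G v W β Δx (lt_min hε₁ hε₂)
  exact ODE_solution_unique_of_mem_Icc_right (v := fun _ => field G v W β Δx)
    (s := fun _ => box V (min ε₁ ε₂)) (K := K) (fun _ _ => hK) hαc
    (fun t ht => hasDerivWithinAt_Ici_of_Icc ht (hα t (Ico_subset_Icc_self ht)).2)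
    (fun t ht i => ⟨(min_le_left _ _).trans (h₁ t (Ico_subset_Icc_self ht) i).1,
      (h₁ t (Ico_subset_Icc_self ht) i).2⟩) hγc
    (fun t ht => hasDerivWithinAt_Ici_of_Icc ht (hγ t (Ico_subset_Icc_self ht)).2)
    (fun t ht i => ⟨(min_le_right _ _).trans (h₂ t (Ico_subset_Icc_self ht) i).1,
      (h₂ t (Ico_subset_Icc_self ht) i).2⟩) h0

lemma isSolution_iff {v : V → ℝ} {W : Matrix V V ℝ} (hW : W.IsSymm) {β Δx : ℝ}
    {ρ : ℝ → V → ℝ} : IsSolution G v W β Δx ρ ↔ ∀ t, 0 ≤ t → ρ t ∈ posSimplex V ∧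
      HasDerivWithinAt ρ (field G v W β Δx (ρ t)) (Ici 0) t := by
  refine forall_congr' fun t => imp_congr_right fun _ => and_congr_right fun h => ?_
  rw [schemeRHS_eq G hW h.1]
  rfl

lemma eqOn_of_isSolution [Nonempty V] {v : V → ℝ} {W : Matrix V V ℝ} (hW : W.IsSymm) {β Δx : ℝ}
    {ρ σ : ℝ → V → ℝ} (hρ : IsSolution G v W β Δx ρ) (hσ : IsSolution G v W β Δx σ)
    (h0 : σ 0 = ρ 0) : EqOn σ ρ (Ici 0) := by
  rw [isSolution_iff G hW] at hρ hσ
  intro t ht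
  exact eqOn_field_solution G v W β Δx ht
    (fun s hs => ⟨(hσ s hs.1).1, (hσ s hs.1).2.mono Icc_subset_Ici_self⟩)
    (fun s hs => ⟨(hρ s hs.1).1, (hρ s hs.1).2.mono Icc_subset_Ici_self⟩) h0 ⟨ht, le_rfl⟩

lemma exists_isSolution [Nonempty V] (v : V → ℝ) {W : Matrix V V ℝ} (hW : W.IsSymm) {β : ℝ}
    (hβ : 0 < β) (Δx : ℝ) {ρ₀ : V → ℝ} (hρ₀ : ρ₀ ∈ posSimplex V) :
    ∃ ρ, IsSolution G v W β Δx ρ ∧ ρ 0 = ρ₀ := by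
  choose! α hα0 hα using fun T (hT : 0 ≤ T) =>
    exists_field_solution_Icc G v W hβ Δx hρ₀ hT
  have hrestrict : ∀ S T, 0 ≤ S → S ≤ T → EqOn (α S) (α T) (Icc 0 S) := fun S T hS hST =>
    eqOn_field_solution G v W β Δx hS (hα S hS)
      (fun t ht => ⟨(hα T (hS.trans hST) t ⟨ht.1, ht.2.trans hST⟩).1,
        (hα T (hS.trans hST) t ⟨ht.1, ht.2.trans hST⟩).2.mono (Icc_subset_Icc_right hST)⟩)
      (by rw [hα0 S hS, hα0 T (hS.trans hST)])
  have heq : ∀ T t, t ∈ Icc 0 T → α t t = α T t := fun T t ht =>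
    hrestrict t T ht.1 ht.2 ⟨ht.1, le_rfl⟩
  refine ⟨fun t => α t t, (isSolution_iff G hW).2 fun t ht => ?_, hα0 0 le_rfl⟩
  -- Using `t + 1` keeps `t` off the right endpoint, so the derivative within `[0, t + 1]` is one
  -- within `[0, ∞)`.
  have htT : t ∈ Icc 0 (t + 1) := ⟨ht, by linarith⟩
  have h := hα (t + 1) (by linarith) t htT
  simp only [heq (t + 1) t htT]
  refine ⟨h.1, ?_⟩
  have hd := h.2.congr (fun s hs => heq (t + 1) s hs) (heq (t + 1) t htT)
  refine hd.mono_of_mem_nhdsWithin ?_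
  filter_upwards [self_mem_nhdsWithin, mem_nhdsWithin_of_mem_nhds (Iio_mem_nhds (lt_add_one t))]
    with s hs hs' using ⟨hs, le_of_lt hs'⟩

end WellPosedness

/-! ### Energy decay and the global attractor. -/

section LongTimeBehaviour

/-- Grönwall's inequality for an exponentially dissipated quantity. -/
lemma le_exp_mul_of_dissipation {E E' : ℝ → ℝ} {a T : ℝ} (hT : 0 ≤ T)
    (hE : ∀ t, 0 ≤ t → HasDerivWithinAt E (E' t) (Ici 0) t)
    (hle : ∀ t, T ≤ t → E' t ≤ -a * E t) {t : ℝ} (ht : T ≤ t) :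
    E t ≤ Real.exp (-a * (t - T)) * E T := by
  have hexp : ∀ t, HasDerivAt (fun t => Real.exp (a * (t - T))) (Real.exp (a * (t - T)) * a) t :=
    fun t => by simpa using (((hasDerivAt_id t).sub_const T).const_mul a).exp
  have hanti : AntitoneOn (fun t => Real.exp (a * (t - T)) * E t) (Ici T) := by
    refine antitoneOn_of_hasDerivWithinAt_nonpos
      (f' := fun t => Real.exp (a * (t - T)) * a * E t + Real.exp (a * (t - T)) * E' t)
      (convex_Ici T) (fun t ht => ?_) (fun t ht => ?_) fun t ht => ?_
    · exact (((hexp t).hasDerivWithinAt.mul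
        ((hE t (hT.trans ht)).mono (Ici_subset_Ici.2 hT))).continuousWithinAt)
    · rw [interior_Ici] at ht ⊢
      exact (hexp t).hasDerivWithinAt.mul ((hE t (hT.trans (le_of_lt ht))).mono
        fun s hs => hT.trans (le_of_lt hs))
    · rw [interior_Ici] at ht
      have h1 := mul_le_mul_of_nonneg_left (hle t (le_of_lt ht)) (Real.exp_pos (a * (t - T))).le
      linarith
  have h := hanti (mem_Ici.2 le_rfl) (mem_Ici.2 ht) ht
  simp only [sub_self, mul_zero, Real.exp_zero, one_mul] at h
  calc E t = Real.exp (-a * (t - T)) * (Real.exp (a * (t - T)) * E t) := by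
        rw [← mul_assoc, ← Real.exp_add]; simp
    _ ≤ _ := by gcongr

variable (G : SimpleGraph V) [DecidableRel G.Adj]

/-- Energy dissipation along the scheme. -/
lemma hasDerivWithinAt_freeEnergy_sub {v : V → ℝ} {W : Matrix V V ℝ} (hW : W.IsSymm)
    {β Δx : ℝ} (e : ℝ) {ρ : ℝ → V → ℝ} (hρ : IsSolution G v W β Δx ρ) {t : ℝ} (ht : 0 ≤ t) :
    HasDerivWithinAt (fun t => freeEnergy v W β (ρ t) - e)
      (-(dirichlet G (ρ t) (potential v W β (ρ t)) / Δx ^ 2)) (Ici 0) t := by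
  obtain ⟨h1, h2⟩ := (isSolution_iff G hW).1 hρ t ht
  refine ((hasDerivWithinAt_freeEnergy (v := v) hW (β := β) h2 h1.1).sub_const e).congr_deriv ?_
  rw [← sum_self_mul_flux, Finset.sum_div, ← Finset.sum_neg_distrib]
  exact Finset.sum_congr rfl fun i _ => by rw [field]; ring

lemma freeEnergy_le_exp_mul {v : V → ℝ} {W : Matrix V V ℝ} (hW : W.IsSymm) {β Δx : ℝ}
    (hΔx : 0 < Δx) {e a T : ℝ} {ρ : ℝ → V → ℝ} (hρ : IsSolution G v W β Δx ρ) (hT : 0 ≤ T)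
    (h : ∀ t, T ≤ t → a * Δx ^ 2 * (freeEnergy v W β (ρ t) - e) ≤
      dirichlet G (ρ t) (potential v W β (ρ t))) {t : ℝ} (ht : T ≤ t) :
    freeEnergy v W β (ρ t) - e ≤ Real.exp (-a * (t - T)) * (freeEnergy v W β (ρ T) - e) := by
  refine le_exp_mul_of_dissipation (E := fun t => freeEnergy v W β (ρ t) - e) hT
    (fun t ht => hasDerivWithinAt_freeEnergy_sub G hW e hρ ht) (fun t ht => ?_) ht
  rw [neg_mul, neg_le_neg_iff, le_div_iff₀ (by positivity)]
  linarith [h t ht]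

lemma dist_lt_of_freeEnergy_lt {v : V → ℝ} {W : Matrix V V ℝ} (hW : W.PosSemidef) {β : ℝ}
    (hβ : 0 < β) {p ρ : V → ℝ} {c : ℝ} (hp : p ∈ posSimplex V)
    (hc : ∀ i, potential v W β p i = c) (hρ : ρ ∈ posSimplex V) {ε : ℝ} (hε : 0 < ε)
    (h : freeEnergy v W β ρ - freeEnergy v W β p < β / 4 * ε ^ 2) : dist ρ p < ε := by
  have h1 := quadratic_growth hW hβ hp hc hρ
  have h2 := norm_sq_le_sum_sq (ρ - p)
  rw [dist_eq_norm]
  refine lt_of_pow_lt_pow_left₀ 2 hε.le (h2.trans_lt ?_)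
  exact lt_of_mul_lt_mul_left (h1.trans_lt h) (by positivity)

/-- A critical point for which the entropy-dissipation inequality holds is a global attractor. -/
lemma isGlobalAttractor {v : V → ℝ} {W : Matrix V V ℝ} (hW : W.PosSemidef)
    {β Δx : ℝ} (hβ : 0 < β) {p : V → ℝ} {c C : ℝ} (hp : p ∈ posSimplex V)
    (hc : ∀ i, potential v W β p i = c) (hC : 0 < C)
    (hdecay : ∀ ρ : ℝ → V → ℝ, IsSolution G v W β Δx ρ → ∀ t, 0 ≤ t →
      freeEnergy v W β (ρ t) - freeEnergy v W β p ≤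
        Real.exp (-C * t) * (freeEnergy v W β (ρ 0) - freeEnergy v W β p)) :
    IsGlobalAttractor G v W β Δx p := by
  have hE0 : ∀ ρ ∈ posSimplex V, 0 ≤ freeEnergy v W β ρ - freeEnergy v W β p := fun ρ hρ =>
    le_trans (by positivity) (quadratic_growth hW hβ hp hc hρ)
  have huniform : ∀ ε > 0, ∃ T > 0, ∀ ρ : ℝ → V → ℝ, IsSolution G v W β Δx ρ →
      ∀ t, T ≤ t → dist (ρ t) p < ε := by
    intro ε hε
    -- The energy is bounded on the simplex, so one decay time serves all initial data.
    obtain ⟨M, hM⟩ := (isCompact_stdSimplex ℝ V).bddAbove_image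
      (continuous_freeEnergy v W β).continuousOn
    have hlim : Tendsto (fun t : ℝ => Real.exp (-C * t) * (M - freeEnergy v W β p)) atTop
        (𝓝 0) := by
      have : Tendsto (fun t : ℝ => -C * t) atTop atBot :=
        tendsto_id.const_mul_atTop_of_neg (neg_neg_of_pos hC)
      simpa using (Real.tendsto_exp_atBot.comp this).mul_const (M - freeEnergy v W β p)
    obtain ⟨T, hT⟩ := eventually_atTop.1
      (hlim.eventually_lt_const (show 0 < β / 4 * ε ^ 2 by positivity))
    refine ⟨max T 1, by positivity, fun ρ hρ t ht => ?_⟩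
    have ht0 : 0 ≤ t := by linarith [(le_max_right T 1).trans ht]
    refine dist_lt_of_freeEnergy_lt hW hβ hp hc (hρ t ht0).1 hε
      ((hdecay ρ hρ t ht0).trans_lt (lt_of_le_of_lt ?_ (hT t ((le_max_left T 1).trans ht))))
    have h0 := (hρ 0 le_rfl).1
    have hle : freeEnergy v W β (ρ 0) ≤ M := hM ⟨ρ 0, ⟨fun i => (h0.1 i).le, h0.2⟩, rfl⟩
    gcongr
  refine ⟨hp, ?_, fun ε hε => ?_, fun ρ hρ => ?_, huniform⟩
  · rw [schemeRHS_eq G (posSemidef_isSymm hW) hp.1]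
    ext i
    simp [flux, hc]
  · obtain ⟨δ, hδ, hlt⟩ := Metric.eventually_nhds_iff.1
      ((((continuous_freeEnergy v W β).tendsto p).sub_const (freeEnergy v W β p)).eventually_lt_const
        (show freeEnergy v W β p - freeEnergy v W β p < β / 4 * ε ^ 2 by
          rw [sub_self]; positivity))
    refine ⟨δ, hδ, fun ρ hρ h0 t ht => ?_⟩
    refine dist_lt_of_freeEnergy_lt hW hβ hp hc (hρ t ht).1 hε (lt_of_le_of_lt ?_ (hlt h0))
    refine (hdecay ρ hρ t ht).trans (mul_le_of_le_one_left (hE0 _ (hρ 0 le_rfl).1) ?_)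
    exact Real.exp_le_one_iff.2 (by nlinarith)
  · refine Metric.tendsto_atTop.2 fun ε hε => ?_
    obtain ⟨T, -, h⟩ := huniform ε hε
    exact ⟨T, fun t ht => h ρ hρ t ht⟩

end LongTimeBehaviour

end GraphFlow

end

theorem corollary3p4 {V : Type*} [Fintype V] [DecidableEq V] [Nontrivial V]
    (G : SimpleGraph V) [DecidableRel G.Adj] (hG : G.Connected)
    (v : V → ℝ) (W : Matrix V V ℝ) (hW : W.PosSemidef)
    (β Δx : ℝ) (hβ : 0 < β) (hΔx : 0 < Δx) :
    (∀ ρ₀ ∈ GraphFlow.posSimplex V, ∃ ρ : ℝ → V → ℝ,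
      GraphFlow.IsSolution G v W β Δx ρ ∧ ρ 0 = ρ₀ ∧
      ∀ σ : ℝ → V → ℝ, GraphFlow.IsSolution G v W β Δx σ → σ 0 = ρ₀ →
        Set.EqOn σ ρ (Set.Ici 0)) ∧
    ∃ ρinf : V → ℝ,
      GraphFlow.IsGibbs v W β ρinf ∧
      (∀ σ : V → ℝ, GraphFlow.IsGibbs v W β σ → σ = ρinf) ∧
      GraphFlow.IsGlobalAttractor G v W β Δx ρinf ∧
      (∃ C > 0, ∀ ρ : ℝ → V → ℝ, GraphFlow.IsSolution G v W β Δx ρ → ∀ t, 0 ≤ t →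
        GraphFlow.freeEnergy v W β (ρ t) - GraphFlow.freeEnergy v W β ρinf ≤
          Real.exp (-C * t) *
            (GraphFlow.freeEnergy v W β (ρ 0) - GraphFlow.freeEnergy v W β ρinf)) ∧
      ∃ lam : ℝ, GraphFlow.IsRate G v W β Δx ρinf lam ∧ 0 < lam ∧
        ∀ ρ : ℝ → V → ℝ, GraphFlow.IsSolution G v W β Δx ρ → ∀ ε > 0, ∃ T > 0, ∀ t, T ≤ t →
          GraphFlow.freeEnergy v W β (ρ t) - GraphFlow.freeEnergy v W β ρinf ≤
            Real.exp (-2 * (lam - ε) * (t - T)) *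
              (GraphFlow.freeEnergy v W β (ρ T) - GraphFlow.freeEnergy v W β ρinf) := by
  have hsymm := GraphFlow.posSemidef_isSymm hW
  refine ⟨fun ρ₀ hρ₀ => ?_, ?_⟩
  · obtain ⟨ρ, hρ, h0⟩ := GraphFlow.exists_isSolution G v hsymm hβ Δx hρ₀
    exact ⟨ρ, hρ, h0, fun σ hσ hσ0 => GraphFlow.eqOn_of_isSolution G hsymm hρ hσ (hσ0.trans h0.symm)⟩
  obtain ⟨p, hp, c, hc⟩ := GraphFlow.exists_potential_const v hsymm hβ
  obtain ⟨C, hC, hglobal⟩ := GraphFlow.exists_entropy_dissipation G hG v hW hβ hp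
  obtain ⟨lam, hlam, hrate, hdom⟩ := GraphFlow.exists_isRate G hG v hW hβ hΔx hp
  have hdecay : ∀ ρ : ℝ → V → ℝ, GraphFlow.IsSolution G v W β Δx ρ → ∀ t, 0 ≤ t →
      GraphFlow.freeEnergy v W β (ρ t) - GraphFlow.freeEnergy v W β p ≤
        Real.exp (-(C / Δx ^ 2) * t) *
          (GraphFlow.freeEnergy v W β (ρ 0) - GraphFlow.freeEnergy v W β p) := by
    intro ρ hρ t ht
    have h := GraphFlow.freeEnergy_le_exp_mul G hsymm hΔx (a := C / Δx ^ 2)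
      (e := GraphFlow.freeEnergy v W β p) hρ le_rfl
      (fun s hs => ?_) ht
    · rwa [sub_zero] at h
    · rw [div_mul_cancel₀ C (by positivity)]
      exact hglobal _ (hρ s hs).1
  have hattr := GraphFlow.isGlobalAttractor G hW hβ hp hc (by positivity) hdecay
  refine ⟨p, (GraphFlow.isGibbs_iff hβ).2 ⟨hp, c, hc⟩, fun σ hσ => ?_, hattr,
    ⟨C / Δx ^ 2, by positivity, hdecay⟩, lam, hrate, hlam, fun ρ hρ ε hε => ?_⟩
  · obtain ⟨hσ, d, hd⟩ := (GraphFlow.isGibbs_iff hβ).1 hσ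
    exact GraphFlow.eq_of_potential_const hW hβ hp hc hσ hd
  -- Here `κ = lam * Δx²` and `η = ε * Δx²`; the factor `1 / Δx²` in the energy dissipation restores
  -- the rate `2 (lam - ε)`.
  · have hloc := GraphFlow.eventually_entropy_dissipation G hW hβ hp hc
      (GraphFlow.mul_hess_le_dirichlet G hG hW hβ hp hdom)
      (show 0 < ε * Δx ^ 2 by positivity)
    have hmem : Filter.Tendsto ρ Filter.atTop (nhdsWithin p (GraphFlow.posSimplex V)) :=
      tendsto_nhdsWithin_iff.2 ⟨hattr.converges ρ hρ,
        (Filter.eventually_ge_atTop 0).mono fun t ht => (hρ t ht).1⟩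
    obtain ⟨T, hT⟩ := Filter.eventually_atTop.1 (hmem.eventually hloc)
    refine ⟨max T 1, by positivity, fun t ht => ?_⟩
    have h := GraphFlow.freeEnergy_le_exp_mul G hsymm hΔx (a := 2 * (lam - ε))
      (e := GraphFlow.freeEnergy v W β p) hρ (show 0 ≤ max T 1 by positivity) (fun s hs => ?_) ht
    · rwa [← neg_mul] at h
    · refine le_of_eq_of_le ?_ (hT s ((le_max_left T 1).trans hs))
      ring
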